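/- Fix $A_x,A_\Theta,L_k,L_\eta,A_\eta,A_{op},A_\ell,L_\ell,\sigma_s,\sigma_t,C_s,C_t,\kappa>0$ and a failure probability $\delta>0$. There are constants $c_1,c_2>0$, depending only on these, such that the following holds for every depth $L\ge 1$, width parameter $d\ge 2$, accuracy $0<\epsilon\le 1$ and layer widths $d_0,\dots,d_L\le\kappa d$. Put $$\rho=d^2L\log(L/\epsilon)+d^2L^2\log d .$$ *Network.* Let $B=\{x\in\mathbb R^{d_0}:\|x\|\le A_x\}$ be the source and the target input domain. A network with parameters $\theta=(W^l,b^l)_{l=1}^L$ has features $\xi^0=x$, $\xi^l=\eta^l(W^l\xi^{l-1}+b^l)\in\mathbb R^{d_l}$; $\theta$ is admissible if all entries of all $W^l,b^l$ have absolute value at most $A_\Theta$. Each $\eta^l:\mathbb R^{d_l}\to\mathbb R^{d_l}$ is $L_\eta$-Lipschitz in the Euclidean norm ($1\le l\le L$), and for each $l<L$ either all components of $\eta^l$ are bounded by $A_\eta$, or $\|\eta^l(u)\|\le A_{op}\|u\|$ for all $u$. For $1\le l<L$ let $\mathcal X^l$ be a real reproducing kernel Hilbert space on $\mathbb R^{d_l}$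 whose kernel $k^l$ is $L_k$-Lipschitz in each argument, with feature map $\phi^l(\xi)=k^l(\xi,\cdot)$, and let $\mathcal X=\bigoplus_{l<L}\mathcal X^l$. The source and target networks have admissible parameters $\theta_s,\theta_t$ that agree in layer $L$. Write $f^s(x)=(\phi^l(\xi^l_{\theta_s}(x)))_{l<L}\in\mathcal X$ and $(h\circ f^s)(x)=\xi^L_{\theta_s}(x)$, where $h$ is the shared layer $L$, and define $f^t$, $h\circ f^t$ in the same way from $\theta_t$. *Data and loss.* Let $\mathcal Y\subset\mathbb R^{d_L}$ contain all network outputs on $B$ for admissible parameters, let $\ell:\mathcal Y\times\mathcal Y\to[0,A_\ell]$ be measurable and $L_\ell$-Lipschitz in its first argument, and let $\mu_s,\mu_t$ be Borel probability measures on $B\times\mathcal Y$. Let $\mathcal L^s(f^s,h)$ and $\mathcal L^t(f^t,h)$ be the expectations of $\ell(h\circ f^s(x),y)$ under $\mu_s$ and of $\ell(h\circ f^t(x),y)$ under $\mu_t$, and $D(f^s,f^t)=\|E_{\mu_s}f^s-E_{\mu_t}f^t\|_{\mathcal X}$. Assume that for all admissible networks $$E_{\mu_s}\|f^s-E_{\mu_s}f^s\|^k\le\tfrac{k!}{2}\sigma_s^2C_s^{k-2},\qquad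 E_{\mu_t}\|f^t-E_{\mu_t}f^t\|^k\le\tfrac{k!}{2}\sigma_t^2C_t^{k-2}\qquad(k\ge2),$$ and that for some $R>0$ one has $|\mathcal L^s(f^s,h)-\mathcal L^t(f^t,h)|\le R\,D(f^s,f^t)$ for all such $(f^s,f^t,h)$. *Samples.* Draw $N_s$ i.i.d. samples from $\mu_s$, of which the first $M_s\le N_s$ are labeled, and $N_t$ i.i.d. samples from $\mu_t$, of which the first $M_t\le N_t$ are labeled. Let $\hat{\mathcal L}^s,\hat{\mathcal L}^t$ be the average losses over the labeled samples, and $\hat D(f^s,f^t)=\big\|\frac1{N_s}\sum_i f^s(x^s_i)-\frac1{N_t}\sum_j f^t(x^t_j)\big\|_{\mathcal X}$. *Claim.* If $0\le\alpha\le1$, $$\alpha\le c_1\Big(\frac{M_t\epsilon^2}{\rho}\Big)^{1/2}\qquad\text{and}\qquad M_s,\,N_s,\,N_t\ \ge\ c_2\,\frac{\rho}{\epsilon^2},$$ then with probability at least $1-\delta$, simultaneously for all $(f^s,f^t,h)$ as above (hence for any output of a learning algorithm, for instance one that minimizes $(1-\alpha)\hat{\mathcal L}^s+\alpha\hat{\mathcal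 L}^t+\beta\hat D^2$), $$\mathcal L^t(f^t,h)\le(1-\alpha)\hat{\mathcal L}^s(f^s,h)+\alpha\hat{\mathcal L}^t(f^t,h)+(1-\alpha)R\,\hat D(f^s,f^t)+(1-\alpha)R\,\epsilon+\epsilon .$$ -/

import Mathlib

open MeasureTheory ProbabilityTheory

/-- `ℝⁿ` with the Euclidean norm. -/
abbrev Vec (n : ℕ) : Type := EuclideanSpace ℝ (Fin n)

/-- The input domain `{x ∈ ℝⁿ : ‖x‖ ≤ A}`. -/
abbrev InputBall (n : ℕ) (A : ℝ) : Type := Metric.closedBall (0 : Vec n) A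

/-- Parameters of a fully connected network with layer widths `dims 0, dims 1, …`:
`W l` and `b l` are the weight matrix and the bias vector of layer `l + 1`. -/
structure NetParams (dims : ℕ → ℕ) where
  W : ∀ l, Matrix (Fin (dims (l + 1))) (Fin (dims l)) ℝ
  b : ∀ l, Vec (dims (l + 1))

namespace NetParams

variable {dims : ℕ → ℕ}

/-- All weights and biases of layers `1, …, L` have magnitude at most `B`. -/
def BoundedBy (θ : NetParams dims) (L : ℕ) (B : ℝ) : Prop :=
  ∀ l < L, ∀ i, (∀ j, |θ.W l i j| ≤ B) ∧ |θ.b l i| ≤ B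

/-- The two networks have the same parameters in layer `L` (the common classifier). -/
def ShareLayer (θ θ' : NetParams dims) (L : ℕ) : Prop :=
  ∀ l, l + 1 = L → θ.W l = θ'.W l ∧ θ.b l = θ'.b l

/-- The feature vector of layer `l`: `ξ⁰ = x`, `ξ^(l+1) = η^(l+1) (W ξ^l + b)`. -/
noncomputable def feature (θ : NetParams dims) (act : ∀ l, Vec (dims l) → Vec (dims l)) :
    ∀ l, Vec (dims 0) → Vec (dims l)
  | 0, x => x
  | l + 1, x =>
      act (l + 1) (WithLp.toLp 2 ((θ.W l).mulVec (θ.feature act l x).ofLp) + θ.b l)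

end NetParams

/-- The Hilbert direct sum of the spaces attached to the hidden layers `1, …, L - 1`. -/
abbrev HiddenSpace (H : ℕ → Type*) (L : ℕ) : Type _ := PiLp 2 (fun l : Fin (L - 1) => H (l + 1))

section Kernels

variable {n : ℕ} (H : Type*) [NormedAddCommGroup H] [InnerProductSpace ℝ H] [CompleteSpace H]
  [RKHS ℝ H (Vec n) ℝ]

/-- The canonical feature map `φ(ξ) = k(ξ, ·)` of a real reproducing kernel Hilbert space. -/
noncomputable def featureMap (ξ : Vec n) : H := RKHS.kerFun H ξ (1 : ℝ)

/-- The real-valued reproducing kernel `k(ξ, ξ') = ⟪φ(ξ), φ(ξ')⟫`. -/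
noncomputable def kernelFun (ξ ξ' : Vec n) : ℝ := RKHS.kernel H ξ ξ' (1 : ℝ)

end Kernels

section Transforms

variable {dims : ℕ → ℕ} (H : ℕ → Type*) [∀ l, NormedAddCommGroup (H l)]
  [∀ l, InnerProductSpace ℝ (H l)] [∀ l, CompleteSpace (H l)]
  [∀ l, RKHS ℝ (H l) (Vec (dims l)) ℝ]

/-- The transformation `x ↦ (φ¹(ξ¹(x)), …, φ^(L-1)(ξ^(L-1)(x)))` of a network of depth `L`. -/
noncomputable def transform (act : ∀ l, Vec (dims l) → Vec (dims l)) (L : ℕ) {A : ℝ}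
    (θ : NetParams dims) (x : InputBall (dims 0) A) : HiddenSpace H L :=
  WithLp.toLp 2 fun l : Fin (L - 1) => featureMap (H (l + 1)) (θ.feature act (l + 1) x)

end Transforms

/-- The network output `h ∘ f`, that is, the feature vector of layer `L`. -/
noncomputable def output {dims : ℕ → ℕ} (act : ∀ l, Vec (dims l) → Vec (dims l)) (L : ℕ) {A : ℝ}
    (θ : NetParams dims) (x : InputBall (dims 0) A) : Vec (dims L) :=
  θ.feature act L x

section Losses

variable {X X' V E : Type*} [MeasurableSpace X] [MeasurableSpace X'] [MeasurableSpace V]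
  {Y : Set V} [NormedAddCommGroup E] [NormedSpace ℝ E]

/-- The expected loss of a predictor `g`. -/
noncomputable def expLoss (loss : V → V → ℝ) (μ : Measure (X × Y)) (g : X → V) : ℝ :=
  ∫ z, loss (g z.1) z.2 ∂μ

/-- The empirical loss of a predictor `g` on `M` labeled samples. -/
noncomputable def empLoss (loss : V → V → ℝ) {M : ℕ} (z : Fin M → X × Y) (g : X → V) : ℝ :=
  (1 / M : ℝ) * ∑ i, loss (g (z i).1) (z i).2

/-- The maximum mean discrepancy of the transformed source and target domains. -/
noncomputable def mmd (μ : Measure (X × Y)) (ν : Measure (X' × Y)) (f : X → E) (f' : X' → E) : ℝ :=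
  ‖∫ z, f z.1 ∂μ - ∫ z, f' z.1 ∂ν‖

/-- The empirical maximum mean discrepancy. -/
noncomputable def empMMD {N N' : ℕ} (z : Fin N → X × Y) (z' : Fin N' → X' × Y)
    (f : X → E) (f' : X' → E) : ℝ :=
  ‖(1 / N : ℝ) • ∑ i, f (z i).1 - (1 / N' : ℝ) • ∑ j, f' (z' j).1‖

/-- Bernstein moment condition: `E‖f(x) - E f(x)‖ᵏ ≤ (k!/2) σ² Cᵏ⁻²` for all `k ≥ 2`
(for `k = 2` this is the variance bound). -/
def BernsteinMoments (μ : Measure (X × Y)) (f : X → E) (σ C : ℝ) : Prop :=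
  ∀ k : ℕ, 2 ≤ k →
    ∫ z, ‖f z.1 - ∫ w, f w.1 ∂μ‖ ^ k ∂μ ≤ (k.factorial : ℝ) / 2 * σ ^ 2 * C ^ (k - 2)

end Losses

/-- `d² L log (L / ε) + d² L² log d`. -/
noncomputable def complexityRate (L d : ℕ) (ε : ℝ) : ℝ :=
  (d : ℝ) ^ 2 * L * Real.log (L / ε) + (d : ℝ) ^ 2 * (L : ℝ) ^ 2 * Real.log d

/-!
The target loss is split as `(1 - α) L^t + α L^t`. In the first part the domain adaptation inequality
replaces `L^t` by `L^s + R D`; it then remains to compare `L^s`, `D` and `α L^t` with their empirical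
counterparts, uniformly over all admissible networks. Two ingredients achieve this.

*Concentration.* The features take values in a Hilbert space of arbitrary dimension, and their
deviations from the mean are bounded only by constants that grow with the depth, so a Bernstein inequality with dimension-free constants
is needed (`measure_pi_norm_sum_ge_le`). It follows from Pinelis' inequality `cosh_norm_add_le`:
since `t ↦ cosh √t` is convex, `cosh ‖s + x‖` is at most `cosh ‖s‖ (exp ‖x‖ - ‖x‖)` plus a term linear
in `x`, which vanishes on average for a centered `x`. Hence `E cosh (r ‖S‖)` grows at most
geometrically along the partial sums `S`, at a rate that the moment condition controls. The losses
are the one-dimensional case, because a variable with values in `[0, A]` satisfies the moment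
condition with both constants equal to `A`.

*Entropy.* Rounding the `O(d² L)` parameters to a grid gives a finite net of networks. Perturbing the
parameters by `τ` perturbs the features of all layers by at most `τ L (G d)^(L + 1)`,
with `G` depending only on the fixed constants (`NetParams.norm_feature_sub_le`), and the kernel feature maps are Hölder continuous with exponent
`1 / 2` (`norm_featureMap_sub_sq_le`). A grid spacing of order `ε² / (L² (G d)^(L + 1))` therefore
suffices, and the logarithm of the size of the net is at most a constant times `complexityRate`
(`exists_featureNet`). A union bound over the net yields the uniform laws.

The target loss is multiplied by `α`, so its sample may be small: either there are so few labeled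
target samples that `α A_ℓ ≤ ε / 2` already, or the deviation, of order `√(ρ / M_t)`, is compensated
by `α` (`exists_measure_le_targetWeight_mul_sub_le`).
-/

/-! ### A Bernstein inequality in Hilbert space -/

/-- Convexity of `t ↦ cosh √t`, in a form that avoids the square root. -/
lemma Real.cosh_le_of_sq_eq {p q r u v : ℝ} (hp : 0 ≤ p) (hq : 0 ≤ q) (hpq : p + q = 1)
    (h : r ^ 2 = p * u ^ 2 + q * v ^ 2) : Real.cosh r ≤ p * Real.cosh u + q * Real.cosh v := by
  refine hasSum_le (fun n => ?_) (Real.hasSum_cosh r)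
    (((Real.hasSum_cosh u).mul_left p).add ((Real.hasSum_cosh v).mul_left q))
  have key := (convexOn_pow (𝕜 := ℝ) n).2 (sq_nonneg u) (sq_nonneg v) hp hq hpq
  simp only [smul_eq_mul] at key
  rw [← h, ← pow_mul, ← pow_mul, ← pow_mul] at key
  calc r ^ (2 * n) / ((2 * n).factorial : ℝ)
      ≤ (p * u ^ (2 * n) + q * v ^ (2 * n)) / ((2 * n).factorial : ℝ) := by gcongr
    _ = _ := by ring

/-- Pinelis' inequality: up to a term that is linear in the increment `x`, adding `x` multiplies
`cosh ‖s‖` by at most `exp ‖x‖ - ‖x‖`. -/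
lemma cosh_norm_add_le {E : Type*} [NormedAddCommGroup E] [InnerProductSpace ℝ E] (s x : E) :
    Real.cosh ‖s + x‖ ≤ Real.cosh ‖s‖ * (Real.exp ‖x‖ - ‖x‖)
      + Real.sinh ‖s‖ / ‖s‖ * inner ℝ s x := by
  have hsinh : ∀ b : ℝ, 0 ≤ b → b ≤ Real.sinh b := fun b hb => Real.self_le_sinh_iff.2 hb
  rcases eq_or_ne s 0 with rfl | hs
  · have := hsinh _ (norm_nonneg x)
    simp [← Real.cosh_add_sinh]
    linarith
  rcases eq_or_ne x 0 with rfl | hx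
  · simp
  set a := ‖s‖
  set b := ‖x‖
  set c : ℝ := inner ℝ s x
  have ha : 0 < a := norm_pos_iff.2 hs
  have hb : 0 < b := norm_pos_iff.2 hx
  have hab : 0 < a * b := mul_pos ha hb
  have hc : |c| ≤ a * b := abs_real_inner_le_norm s x
  obtain ⟨hc1, hc2⟩ := abs_le.1 hc
  -- the endpoints of the range `[-ab, ab]` of the inner product correspond to norms `a ± b`
  have h1 : Real.cosh ‖s + x‖ ≤ (a * b + c) / (2 * (a * b)) * Real.cosh (a + b)
      + (a * b - c) / (2 * (a * b)) * Real.cosh (a - b) := by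
    refine Real.cosh_le_of_sq_eq (by apply div_nonneg <;> linarith)
      (by apply div_nonneg <;> linarith) (by field_simp; ring) ?_
    rw [norm_add_sq_real]
    change a ^ 2 + 2 * c + b ^ 2 = _
    field_simp
    ring
  have h2 : (a * b + c) / (2 * (a * b)) * Real.cosh (a + b)
      + (a * b - c) / (2 * (a * b)) * Real.cosh (a - b)
      = Real.cosh a * Real.cosh b + c / (a * b) * (Real.sinh a * (Real.sinh b - b))
        + Real.sinh a / a * c := by
    rw [Real.cosh_add, Real.cosh_sub]
    field_simp
    ring
  have h3 : c / (a * b) * (Real.sinh a * (Real.sinh b - b)) ≤ Real.cosh a * (Real.sinh b - b) := by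
    have hsb : 0 ≤ Real.sinh b - b := sub_nonneg.2 (hsinh b hb.le)
    have hsa : 0 ≤ Real.sinh a := Real.sinh_nonneg_iff.2 ha.le
    have : c / (a * b) ≤ 1 := (div_le_one hab).2 hc2
    calc c / (a * b) * (Real.sinh a * (Real.sinh b - b)) ≤ 1 * (Real.sinh a * (Real.sinh b - b)) := by
          gcongr
      _ ≤ _ := by
          rw [one_mul]
          gcongr
          exact (Real.sinh_lt_cosh a).le
  have h4 : Real.exp b = Real.cosh b + Real.sinh b := (Real.cosh_add_sinh b).symm
  rw [h4]
  linarith [h1, h2, h3]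

lemma integrable_comp_norm_of_bounded {Z E : Type*} [MeasurableSpace Z] [NormedAddCommGroup E]
    {μ : Measure Z} [IsFiniteMeasure μ] {F : Z → E}
    (hF : StronglyMeasurable F) {B : ℝ} (hB : ∀ z, ‖F z‖ ≤ B) {g : ℝ → ℝ} (hg : Continuous g) :
    Integrable (fun z => g ‖F z‖) μ := by
  obtain ⟨C, hC⟩ := (isCompact_Icc (a := (0 : ℝ)) (b := B)).exists_bound_of_continuousOn
    hg.continuousOn
  exact Integrable.of_bound (hg.comp_stronglyMeasurable hF.norm).aestronglyMeasurable C
    (ae_of_all _ fun z => hC _ ⟨norm_nonneg _, hB z⟩)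

/-- Bernstein's moment condition bounds the exponential moment that governs the growth of
`E cosh ‖S‖` for the partial sums `S`. -/
lemma integral_exp_sub_le_of_moments {Z E : Type*} [MeasurableSpace Z] [NormedAddCommGroup E]
    [NormedSpace ℝ E] {μ : Measure Z} [IsProbabilityMeasure μ] {F : Z → E}
    (hF : StronglyMeasurable F) {B : ℝ} (hB : ∀ z, ‖F z‖ ≤ B) {σ C : ℝ} (hC : 0 < C)
    (hmom : ∀ k : ℕ, 2 ≤ k →
      ∫ z, ‖F z‖ ^ k ∂μ ≤ (k.factorial : ℝ) / 2 * σ ^ 2 * C ^ (k - 2))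
    {r : ℝ} (hr : 0 ≤ r) (hrC : r * C ≤ 1 / 2) :
    ∫ z, (Real.exp ‖r • F z‖ - ‖r • F z‖) ∂μ ≤ Real.exp (r ^ 2 * σ ^ 2) := by
  have hB0 : ∀ z, ‖F z‖ ≤ |B| := fun z => (hB z).trans (le_abs_self B)
  set T : ℕ → Z → ℝ := fun k z => (r * ‖F z‖) ^ (k + 2) / ((k + 2).factorial : ℝ)
  have hT0 : ∀ k z, 0 ≤ T k z := fun k z => by positivity
  have hexp : ∀ z, HasSum (fun k => T k z) (Real.exp ‖r • F z‖ - ‖r • F z‖ - 1) := by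
    intro z
    rw [norm_smul, Real.norm_of_nonneg hr]
    have h := NormedSpace.expSeries_div_hasSum_exp (𝔸 := ℝ) (r * ‖F z‖)
    rw [← Real.exp_eq_exp_ℝ] at h
    have := (hasSum_nat_add_iff' 2).2 h
    simpa [Finset.sum_range_succ, sub_sub, add_comm] using this
  have hTi : ∀ k, Integrable (T k) μ := fun k =>
    integrable_comp_norm_of_bounded hF hB (g := fun t => (r * t) ^ (k + 2) / ((k + 2).factorial : ℝ))
      (by fun_prop)
  have hTint : ∀ k, ∫ z, T k z ∂μ ≤ r ^ 2 * σ ^ 2 / 2 * (1 / 2 : ℝ) ^ k := by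
    intro k
    have hf : (0 : ℝ) < ((k + 2).factorial : ℝ) := by positivity
    have h := hmom (k + 2) (by omega)
    calc ∫ z, T k z ∂μ = r ^ (k + 2) / ((k + 2).factorial : ℝ) * ∫ z, ‖F z‖ ^ (k + 2) ∂μ := by
          rw [← integral_const_mul]
          congr 1 with z
          simp only [T]
          ring
      _ ≤ r ^ (k + 2) / ((k + 2).factorial : ℝ)
            * (((k + 2).factorial : ℝ) / 2 * σ ^ 2 * C ^ (k + 2 - 2)) := by gcongr
      _ = r ^ 2 * σ ^ 2 / 2 * (r * C) ^ k := by
          rw [Nat.add_sub_cancel]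
          field_simp
          ring
      _ ≤ _ := by gcongr
  have hgeo : HasSum (fun k : ℕ => r ^ 2 * σ ^ 2 / 2 * (1 / 2 : ℝ) ^ k) (r ^ 2 * σ ^ 2) := by
    have h := hasSum_geometric_two.mul_left (r ^ 2 * σ ^ 2 / 2)
    rwa [div_mul_cancel₀ _ two_ne_zero] at h
  have hnorm : ∀ k, ∫ z, ‖T k z‖ ∂μ = ∫ z, T k z ∂μ := fun k => by
    congr 1 with z
    exact Real.norm_of_nonneg (hT0 k z)
  have hs : Summable fun k => ∫ z, ‖T k z‖ ∂μ := by
    simp_rw [hnorm]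
    exact Summable.of_nonneg_of_le (fun k => integral_nonneg (hT0 k)) hTint hgeo.summable
  have hsum := hasSum_integral_of_summable_integral_norm hTi hs
  have hle := hasSum_le hTint hsum hgeo
  have heq : ∀ z, Real.exp ‖r • F z‖ - ‖r • F z‖ = 1 + ∑' k, T k z := fun z => by
    rw [(hexp z).tsum_eq]
    ring
  have hi : Integrable (fun z => ∑' k, T k z) μ := by
    have : (fun z => ∑' k, T k z) = fun z => Real.exp (r * ‖F z‖) - r * ‖F z‖ - 1 := by
      ext z
      rw [(hexp z).tsum_eq, norm_smul, Real.norm_of_nonneg hr]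
    rw [this]
    exact integrable_comp_norm_of_bounded hF hB (g := fun t => Real.exp (r * t) - r * t - 1)
      (by fun_prop)
  simp_rw [heq]
  rw [integral_add (integrable_const _) hi]
  simp only [integral_const, probReal_univ, smul_eq_mul, one_mul]
  linarith [Real.add_one_le_exp (r ^ 2 * σ ^ 2)]

section Bernstein

variable {Z E : Type*} [MeasurableSpace Z] [NormedAddCommGroup E] [InnerProductSpace ℝ E]
  [CompleteSpace E]

/-- The linear term of Pinelis' inequality vanishes on average for a centered increment. -/
lemma lintegral_cosh_norm_add_le {μ : Measure Z} [IsProbabilityMeasure μ] {F : Z → E}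
    (hF : StronglyMeasurable F) {B : ℝ} (hB : ∀ z, ‖F z‖ ≤ B) (h0 : ∫ z, F z ∂μ = 0)
    {K : ℝ} (hK : ∫ z, (Real.exp ‖F z‖ - ‖F z‖) ∂μ ≤ K) (s : E) :
    ∫⁻ z, ENNReal.ofReal (Real.cosh ‖s + F z‖) ∂μ ≤ ENNReal.ofReal (Real.cosh ‖s‖ * K) := by
  have hFi : Integrable F μ := Integrable.of_bound hF.aestronglyMeasurable B (ae_of_all _ hB)
  have hi1 : Integrable (fun z => Real.cosh ‖s + F z‖) μ :=
    integrable_comp_norm_of_bounded (F := fun z => s + F z) (stronglyMeasurable_const.add hF)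
      (fun z => (norm_add_le _ _).trans (add_le_add_right (hB z) ‖s‖)) Real.continuous_cosh
  have hi2 : Integrable (fun z => Real.exp ‖F z‖ - ‖F z‖) μ :=
    integrable_comp_norm_of_bounded hF hB (g := fun t => Real.exp t - t) (by fun_prop)
  have hi3 : Integrable (fun z => Real.sinh ‖s‖ / ‖s‖ * inner ℝ s (F z)) μ :=
    (hFi.const_inner s).const_mul _
  rw [← ofReal_integral_eq_lintegral_ofReal hi1 (ae_of_all _ fun z => (Real.cosh_pos _).le)]
  apply ENNReal.ofReal_le_ofReal
  calc ∫ z, Real.cosh ‖s + F z‖ ∂μ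
      ≤ ∫ z, (Real.cosh ‖s‖ * (Real.exp ‖F z‖ - ‖F z‖)
          + Real.sinh ‖s‖ / ‖s‖ * inner ℝ s (F z)) ∂μ :=
        integral_mono hi1 ((hi2.const_mul _).add hi3) fun z => cosh_norm_add_le s (F z)
    _ = Real.cosh ‖s‖ * ∫ z, (Real.exp ‖F z‖ - ‖F z‖) ∂μ := by
        rw [integral_add (hi2.const_mul _) hi3, integral_const_mul, integral_const_mul,
          integral_inner hFi, h0]
        simp
    _ ≤ _ := by
        gcongr

/-- Iterating over independent increments, `E cosh ‖s + S‖` grows at most geometrically. The start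
`s` is arbitrary so that the induction can split off the first increment. -/
lemma lintegral_cosh_norm_sum_le {μ : Measure Z} [IsProbabilityMeasure μ] {F : Z → E}
    (hF : StronglyMeasurable F) {B : ℝ} (hB : ∀ z, ‖F z‖ ≤ B) (h0 : ∫ z, F z ∂μ = 0)
    {K : ℝ} (hK0 : 0 ≤ K) (hK : ∫ z, (Real.exp ‖F z‖ - ‖F z‖) ∂μ ≤ K) (n : ℕ) (s : E) :
    ∫⁻ z, ENNReal.ofReal (Real.cosh ‖s + ∑ i, F (z i)‖) ∂(Measure.pi fun _ : Fin n => μ)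
      ≤ ENNReal.ofReal (Real.cosh ‖s‖ * K ^ n) := by
  induction n generalizing s with
  | zero => simp
  | succ n ih =>
    have hmp := (measurePreserving_piFinSuccAbove (fun _ : Fin (n + 1) => μ) 0).symm
    rw [← hmp.lintegral_comp_emb (MeasurableEquiv.measurableEmbedding _)]
    have hm : Measurable fun y : Z × (Fin n → Z) =>
        ENNReal.ofReal (Real.cosh ‖s + (F y.1 + ∑ i, F (y.2 i))‖) := by
      apply ENNReal.measurable_ofReal.comp
      apply Real.continuous_cosh.measurable.comp
      apply StronglyMeasurable.measurable
      apply StronglyMeasurable.norm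
      apply stronglyMeasurable_const.add
      apply (hF.comp_measurable measurable_fst).add
      apply Finset.stronglyMeasurable_fun_sum
      intro i _
      exact hF.comp_measurable ((measurable_pi_apply i).comp measurable_snd)
    have hsum : ∀ y : Z × (Fin n → Z),
        ∑ i, F ((MeasurableEquiv.piFinSuccAbove (fun _ : Fin (n + 1) => Z) 0).symm y i)
          = F y.1 + ∑ i, F (y.2 i) := by
      intro y
      rw [Fin.sum_univ_succ]
      rfl
    simp_rw [hsum]
    rw [lintegral_prod _ hm.aemeasurable]
    calc _ ≤ ∫⁻ z, ENNReal.ofReal (Real.cosh ‖s + F z‖ * K ^ n) ∂μ := by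
          apply lintegral_mono
          intro z
          simpa only [add_assoc] using ih (s + F z)
      _ = (∫⁻ z, ENNReal.ofReal (Real.cosh ‖s + F z‖) ∂μ) * ENNReal.ofReal (K ^ n) := by
          simp_rw [ENNReal.ofReal_mul (Real.cosh_pos _).le]
          rw [lintegral_mul_const' _ _ ENNReal.ofReal_ne_top]
      _ ≤ ENNReal.ofReal (Real.cosh ‖s‖ * K) * ENNReal.ofReal (K ^ n) := by
          gcongr
          exact lintegral_cosh_norm_add_le hF hB h0 hK s
      _ = _ := by
          rw [← ENNReal.ofReal_mul (mul_nonneg (Real.cosh_pos _).le hK0)]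
          ring_nf

/-- The exponent in Bernstein's inequality for deviations at most `1`. -/
noncomputable def bernsteinRate (σ C : ℝ) : ℝ := min (1 / (2 * σ ^ 2)) (1 / (2 * C)) / 2

lemma bernsteinRate_pos {σ C : ℝ} (hσ : 0 < σ) (hC : 0 < C) : 0 < bernsteinRate σ C := by
  unfold bernsteinRate
  positivity

/-- Bernstein's inequality for independent centered vectors in a Hilbert space. -/
lemma measure_pi_norm_sum_ge_le {μ : Measure Z} [IsProbabilityMeasure μ] {F : Z → E}
    (hF : StronglyMeasurable F) {B : ℝ} (hB : ∀ z, ‖F z‖ ≤ B) (h0 : ∫ z, F z ∂μ = 0)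
    {σ C : ℝ} (hσ : 0 < σ) (hC : 0 < C)
    (hmom : ∀ k : ℕ, 2 ≤ k →
      ∫ z, ‖F z‖ ^ k ∂μ ≤ (k.factorial : ℝ) / 2 * σ ^ 2 * C ^ (k - 2))
    (n : ℕ) {u : ℝ} (hu0 : 0 ≤ u) (hu1 : u ≤ 1) :
    (Measure.pi fun _ : Fin n => μ) {z | n * u ≤ ‖∑ i, F (z i)‖}
      ≤ ENNReal.ofReal (2 * Real.exp (-(bernsteinRate σ C * n * u ^ 2))) := by
  set c := bernsteinRate σ C
  have hc : 0 < c := bernsteinRate_pos hσ hC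
  have hc1 : 2 * c * σ ^ 2 ≤ 1 / 2 := by
    have : 2 * c ≤ 1 / (2 * σ ^ 2) := by
      simp only [c, bernsteinRate]
      linarith [min_le_left (1 / (2 * σ ^ 2)) (1 / (2 * C))]
    calc 2 * c * σ ^ 2 ≤ 1 / (2 * σ ^ 2) * σ ^ 2 := by gcongr
      _ = 1 / 2 := by field_simp
  have hc2 : 2 * c * C ≤ 1 / 2 := by
    have : 2 * c ≤ 1 / (2 * C) := by
      simp only [c, bernsteinRate]
      linarith [min_le_right (1 / (2 * σ ^ 2)) (1 / (2 * C))]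
    calc 2 * c * C ≤ 1 / (2 * C) * C := by gcongr
      _ = 1 / 2 := by field_simp
  -- the optimal exponent, up to constants
  set r := 2 * c * u
  have hr : 0 ≤ r := by positivity
  have hrC : r * C ≤ 1 / 2 := by
    calc r * C = (2 * c * C) * u := by simp only [r]; ring
      _ ≤ (1 / 2) * 1 := by gcongr
      _ = 1 / 2 := by norm_num
  have hK := integral_exp_sub_le_of_moments hF hB hC hmom hr hrC
  have hG : StronglyMeasurable fun z => r • F z := hF.const_smul r
  have hGB : ∀ z, ‖r • F z‖ ≤ r * B := fun z => by
    rw [norm_smul, Real.norm_of_nonneg hr]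
    gcongr
    exact hB z
  have hmain := lintegral_cosh_norm_sum_le hG hGB (by rw [integral_smul, h0, smul_zero])
    (Real.exp_pos _).le hK n 0
  simp only [zero_add, norm_zero, Real.cosh_zero, one_mul, ← Finset.smul_sum] at hmain
  rw [← Real.exp_nat_mul] at hmain
  have hmeas : Measurable fun z : Fin n → Z =>
      ENNReal.ofReal (Real.cosh ‖r • ∑ i, F (z i)‖) := by
    apply ENNReal.measurable_ofReal.comp
    apply Real.continuous_cosh.measurable.comp
    apply StronglyMeasurable.measurable
    apply StronglyMeasurable.norm
    apply StronglyMeasurable.const_smul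
    apply Finset.stronglyMeasurable_fun_sum
    intro i _
    exact hF.comp_measurable (measurable_pi_apply i)
  have hpos : 0 < Real.exp (r * (n * u)) / 2 := by positivity
  have hmarkov := mul_meas_ge_le_lintegral (μ := Measure.pi fun _ : Fin n => μ) hmeas
    (ENNReal.ofReal (Real.exp (r * (n * u)) / 2))
  have hsub : {z : Fin n → Z | n * u ≤ ‖∑ i, F (z i)‖} ⊆
      {z | ENNReal.ofReal (Real.exp (r * (n * u)) / 2)
        ≤ ENNReal.ofReal (Real.cosh ‖r • ∑ i, F (z i)‖)} := by
    intro z hz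
    simp only [Set.mem_ofPred_eq] at hz ⊢
    apply ENNReal.ofReal_le_ofReal
    rw [norm_smul, Real.norm_of_nonneg hr, Real.cosh_eq]
    have h1 : Real.exp (r * (n * u)) ≤ Real.exp (r * ‖∑ i, F (z i)‖) := by gcongr
    have h2 := Real.exp_pos (-(r * ‖∑ i, F (z i)‖))
    linarith
  have hle := (mul_le_mul_right (measure_mono hsub)
    (ENNReal.ofReal (Real.exp (r * (n * u)) / 2))).trans (hmarkov.trans hmain)
  have hne : ENNReal.ofReal (Real.exp (r * (n * u)) / 2) ≠ 0 := by
    simpa using hpos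
  rw [mul_comm, ← ENNReal.le_div_iff_mul_le (Or.inl hne) (Or.inl ENNReal.ofReal_ne_top),
    ← ENNReal.ofReal_div_of_pos hpos] at hle
  refine hle.trans (ENNReal.ofReal_le_ofReal ?_)
  rw [div_div_eq_mul_div, mul_comm, mul_div_assoc, ← Real.exp_sub]
  gcongr
  have h5 : (n : ℝ) * (r ^ 2 * σ ^ 2) = n * u ^ 2 * (2 * c) * (2 * c * σ ^ 2) := by
    simp only [r]; ring
  have h6 : (n : ℝ) * u ^ 2 * (2 * c) * (2 * c * σ ^ 2) ≤ n * u ^ 2 * (2 * c) * (1 / 2) := by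
    gcongr
  rw [h5]
  simp only [r]
  nlinarith [h6]

end Bernstein

/-! ### Uniform deviation of sample means over a class with a finite net -/

lemma norm_sampleMean_sub_sampleMean_le {Z E : Type*} [NormedAddCommGroup E] [NormedSpace ℝ E]
    {n : ℕ} {f g : Z → E} {v : ℝ} (hv : 0 ≤ v)
    (h : ∀ z, ‖f z - g z‖ ≤ v) (x : Fin n → Z) :
    ‖(1 / n : ℝ) • ∑ i, f (x i) - (1 / n : ℝ) • ∑ i, g (x i)‖ ≤ v := by
  rw [← smul_sub, ← Finset.sum_sub_distrib, norm_smul, Real.norm_of_nonneg (by positivity)]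
  rcases Nat.eq_zero_or_pos n with rfl | hn
  · simpa using hv
  have hn' : (0 : ℝ) < n := by exact_mod_cast hn
  calc (1 / n : ℝ) * ‖∑ i, (f (x i) - g (x i))‖ ≤ (1 / n : ℝ) * ∑ i : Fin n, v := by
        gcongr
        exact (norm_sum_le _ _).trans (Finset.sum_le_sum fun i _ => h _)
    _ = v := by
        simp
        field_simp

/-- A random variable with values in `[0, A]` satisfies the Bernstein moment condition. -/
lemma moments_le_of_mem_Icc {Z : Type*} [MeasurableSpace Z] {μ : Measure Z}
    [IsProbabilityMeasure μ] {f : Z → ℝ}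
    (hf : StronglyMeasurable f) {A : ℝ} (hA : 0 < A) (h : ∀ z, 0 ≤ f z ∧ f z ≤ A) (k : ℕ)
    (hk : 2 ≤ k) :
    ∫ z, ‖f z - ∫ w, f w ∂μ‖ ^ k ∂μ ≤ (k.factorial : ℝ) / 2 * A ^ 2 * A ^ (k - 2) := by
  have hfi : Integrable f μ := Integrable.of_bound hf.aestronglyMeasurable A
    (ae_of_all _ fun z => by rw [Real.norm_of_nonneg (h z).1]; exact (h z).2)
  have hm0 : 0 ≤ ∫ w, f w ∂μ := integral_nonneg fun z => (h z).1
  have hm1 : ∫ w, f w ∂μ ≤ A := by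
    calc ∫ w, f w ∂μ ≤ ∫ _w, A ∂μ := integral_mono hfi (integrable_const _) fun z => (h z).2
      _ = A := by simp
  have hb : ∀ z, ‖f z - ∫ w, f w ∂μ‖ ^ k ≤ A ^ k := fun z => by
    gcongr
    rw [Real.norm_eq_abs, abs_le]
    constructor <;> linarith [(h z).1, (h z).2]
  have hfac : (1 : ℝ) ≤ (k.factorial : ℝ) / 2 := by
    have : 2 ≤ k.factorial := (by decide : 2 ≤ Nat.factorial 2).trans (Nat.factorial_le hk)
    have : (2 : ℝ) ≤ (k.factorial : ℝ) := by exact_mod_cast this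
    linarith
  calc ∫ z, ‖f z - ∫ w, f w ∂μ‖ ^ k ∂μ ≤ ∫ _z, A ^ k ∂μ := by
        refine integral_mono_of_nonneg (ae_of_all _ fun z => by positivity) (integrable_const _)
          (ae_of_all _ hb)
    _ = A ^ 2 * A ^ (k - 2) := by
        rw [← pow_add, Nat.add_sub_cancel' hk]
        simp
    _ ≤ (k.factorial : ℝ) / 2 * (A ^ 2 * A ^ (k - 2)) := le_mul_of_one_le_left (by positivity) hfac
    _ = _ := by ring

section Uniform

variable {Z E Ω : Type*} [MeasurableSpace Z] [NormedAddCommGroup E] [InnerProductSpace ℝ E]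
  [CompleteSpace E] [MeasurableSpace Ω]

/-- Bernstein's inequality for the mean of an i.i.d. sample. -/
lemma measure_norm_sampleMean_sub_ge_le {P : Measure Ω} [IsProbabilityMeasure P]
    {μ : Measure Z} [IsProbabilityMeasure μ] {n : ℕ} (hn : 0 < n) {X : Fin n → Ω → Z}
    (hX : ∀ i, Measurable (X i)) (hind : iIndepFun X P) (hlaw : ∀ i, P.map (X i) = μ)
    {f : Z → E} (hf : StronglyMeasurable f) {B : ℝ} (hB : ∀ z, ‖f z‖ ≤ B)
    {σ C : ℝ} (hσ : 0 < σ) (hC : 0 < C)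
    (hmom : ∀ k : ℕ, 2 ≤ k →
      ∫ z, ‖f z - ∫ w, f w ∂μ‖ ^ k ∂μ ≤ (k.factorial : ℝ) / 2 * σ ^ 2 * C ^ (k - 2))
    {u : ℝ} (hu0 : 0 ≤ u) (hu1 : u ≤ 1) :
    P {ω | u ≤ ‖(1 / n : ℝ) • ∑ i, f (X i ω) - ∫ z, f z ∂μ‖}
      ≤ ENNReal.ofReal (2 * Real.exp (-(bernsteinRate σ C * n * u ^ 2))) := by
  set m := ∫ w, f w ∂μ
  have hfi : Integrable f μ := Integrable.of_bound hf.aestronglyMeasurable B (ae_of_all _ hB)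
  have h0 : ∫ z, (f z - m) ∂μ = 0 := by
    rw [integral_sub hfi (integrable_const _)]
    simp [m]
  have hbd : ∀ z, ‖f z - m‖ ≤ B + ‖m‖ := fun z =>
    (norm_sub_le _ _).trans (by gcongr; exact hB z)
  have key := measure_pi_norm_sum_ge_le (hf.sub stronglyMeasurable_const) hbd h0 hσ hC hmom n
    hu0 hu1
  have hmap := hind.map_fun_eq_pi_map (fun i => (hX i).aemeasurable)
  simp_rw [hlaw] at hmap
  rw [← hmap] at key
  refine (measure_mono ?_).trans
    ((Measure.le_map_apply (measurable_pi_lambda _ hX).aemeasurable _).trans key)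
  intro ω hω
  simp only [Set.mem_ofPred_eq, Set.mem_preimage] at hω ⊢
  have hn' : (0 : ℝ) < n := by exact_mod_cast hn
  have heq : ∑ i, (f (X i ω) - m) = (n : ℝ) • ((1 / n : ℝ) • ∑ i, f (X i ω) - m) := by
    rw [smul_sub, smul_smul, mul_one_div_cancel hn'.ne', one_smul, Finset.sum_sub_distrib]
    simp [Nat.cast_smul_eq_nsmul]
  simp only [Pi.sub_apply]
  rw [heq, norm_smul, Real.norm_of_nonneg hn'.le]
  gcongr

/-- A class of functions that is approximated uniformly up to `v` by finitely many of its members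
satisfies a uniform law of large numbers with the deviation `u + 2 v`. -/
lemma measure_exists_norm_sampleMean_sub_gt_le {P : Measure Ω} [IsProbabilityMeasure P]
    {μ : Measure Z} [IsProbabilityMeasure μ] {n : ℕ} (hn : 0 < n) {X : Fin n → Ω → Z}
    (hX : ∀ i, Measurable (X i)) (hind : iIndepFun X P) (hlaw : ∀ i, P.map (X i) = μ)
    {Θ ι : Type*} [Fintype ι] {S : Set Θ} {e : ι → Θ} (heS : ∀ i, e i ∈ S) {f : Θ → Z → E}
    (hf : ∀ θ ∈ S, StronglyMeasurable (f θ)) (hB : ∀ θ ∈ S, ∃ B : ℝ, ∀ z, ‖f θ z‖ ≤ B)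
    {σ C : ℝ} (hσ : 0 < σ) (hC : 0 < C)
    (hmom : ∀ θ ∈ S, ∀ k : ℕ, 2 ≤ k →
      ∫ z, ‖f θ z - ∫ w, f θ w ∂μ‖ ^ k ∂μ ≤ (k.factorial : ℝ) / 2 * σ ^ 2 * C ^ (k - 2))
    {u v : ℝ} (hu0 : 0 ≤ u) (hu1 : u ≤ 1) (hv : 0 ≤ v)
    (hnet : ∀ θ ∈ S, ∃ i, ∀ z, ‖f θ z - f (e i) z‖ ≤ v) :
    P {ω | ¬ ∀ θ ∈ S, ‖(1 / n : ℝ) • ∑ i, f θ (X i ω) - ∫ z, f θ z ∂μ‖ ≤ u + 2 * v}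
      ≤ ENNReal.ofReal
          (Fintype.card ι * (2 * Real.exp (-(bernsteinRate σ C * n * u ^ 2)))) := by
  have hsub : {ω | ¬ ∀ θ ∈ S, ‖(1 / n : ℝ) • ∑ i, f θ (X i ω) - ∫ z, f θ z ∂μ‖ ≤ u + 2 * v} ⊆
      ⋃ j ∈ (Finset.univ : Finset ι),
        {ω | u ≤ ‖(1 / n : ℝ) • ∑ i, f (e j) (X i ω) - ∫ z, f (e j) z ∂μ‖} := by
    intro ω hω
    simp only [Set.mem_ofPred_eq, not_forall, not_le] at hω
    obtain ⟨θ, hθ, hlt⟩ := hω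
    obtain ⟨j, hj⟩ := hnet θ hθ
    simp only [Set.mem_iUnion, Finset.mem_univ, Set.mem_ofPred_eq, exists_const]
    refine ⟨j, ?_⟩
    by_contra! hcon
    have hint : ∀ θ ∈ S, Integrable (f θ) μ := fun θ hθ => by
      obtain ⟨B, hB⟩ := hB θ hθ
      exact Integrable.of_bound (hf θ hθ).aestronglyMeasurable B (ae_of_all _ hB)
    have h1 := norm_sampleMean_sub_sampleMean_le hv hj (fun i => X i ω)
    have h2 : ‖∫ z, f (e j) z ∂μ - ∫ z, f θ z ∂μ‖ ≤ v := by
      rw [← integral_sub (hint _ (heS j)) (hint θ hθ)]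
      have := norm_integral_le_of_norm_le_const (μ := μ) (f := fun z => f (e j) z - f θ z)
        (ae_of_all _ fun z => by rw [norm_sub_rev]; exact hj z)
      simpa using this
    have h3 := norm_add₃_le
      (a := (1 / n : ℝ) • ∑ i, f θ (X i ω) - (1 / n : ℝ) • ∑ i, f (e j) (X i ω))
      (b := (1 / n : ℝ) • ∑ i, f (e j) (X i ω) - ∫ z, f (e j) z ∂μ)
      (c := ∫ z, f (e j) z ∂μ - ∫ z, f θ z ∂μ)
    rw [sub_add_sub_cancel, sub_add_sub_cancel] at h3
    linarith
  refine (measure_mono hsub).trans ((measure_biUnion_finset_le _ _).trans ?_)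
  calc _ ≤ ∑ _j : ι, ENNReal.ofReal (2 * Real.exp (-(bernsteinRate σ C * n * u ^ 2))) := by
        refine Finset.sum_le_sum fun j _ => ?_
        obtain ⟨B, hB⟩ := hB _ (heS j)
        exact measure_norm_sampleMean_sub_ge_le hn hX hind hlaw (hf _ (heS j)) hB hσ hC
          (hmom _ (heS j)) hu0 hu1
    _ = _ := by
        rw [Finset.sum_const, nsmul_eq_mul, Finset.card_univ,
          ENNReal.ofReal_mul (Nat.cast_nonneg _), ENNReal.ofReal_natCast]

end Uniform

/-! ### Feature maps of Lipschitz kernels -/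

section FeatureMap

variable {n : ℕ} (H : Type*) [NormedAddCommGroup H] [InnerProductSpace ℝ H] [CompleteSpace H]
  [RKHS ℝ H (Vec n) ℝ]

lemma inner_featureMap (ξ ξ' : Vec n) :
    inner ℝ (featureMap H ξ) (featureMap H ξ') = kernelFun H ξ ξ' := by
  rw [real_inner_comm, featureMap, featureMap, ← RKHS.kernel_inner]
  simp [kernelFun]

/-- The feature map of a Lipschitz kernel is Hölder continuous with exponent `1 / 2`. -/
lemma norm_featureMap_sub_sq_le {K : ℝ}
    (hK : ∀ ξ₁ ξ₂ ξ : Vec n, |kernelFun H ξ₁ ξ - kernelFun H ξ₂ ξ| ≤ K * ‖ξ₁ - ξ₂‖)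
    (ξ ξ' : Vec n) : ‖featureMap H ξ - featureMap H ξ'‖ ^ 2 ≤ 2 * K * ‖ξ - ξ'‖ := by
  have hsymm : kernelFun H ξ ξ' = kernelFun H ξ' ξ := by
    rw [← inner_featureMap, ← inner_featureMap, real_inner_comm]
  rw [norm_sub_sq_real, ← real_inner_self_eq_norm_sq, ← real_inner_self_eq_norm_sq,
    inner_featureMap, inner_featureMap, inner_featureMap]
  have h1 := (abs_le.1 (hK ξ ξ' ξ)).2
  have h2 := (abs_le.1 (hK ξ ξ' ξ')).1
  linarith

lemma continuous_featureMap {K : ℝ}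
    (hK : ∀ ξ₁ ξ₂ ξ : Vec n, |kernelFun H ξ₁ ξ - kernelFun H ξ₂ ξ| ≤ K * ‖ξ₁ - ξ₂‖) :
    Continuous (featureMap H : Vec n → H) := by
  rw [continuous_iff_continuousAt]
  intro ξ
  rw [ContinuousAt, tendsto_iff_norm_sub_tendsto_zero]
  have hlim : Filter.Tendsto (fun ξ' : Vec n => √(2 * K * ‖ξ' - ξ‖)) (nhds ξ) (nhds 0) := by
    have : Continuous fun ξ' : Vec n => √(2 * K * ‖ξ' - ξ‖) := by fun_prop
    simpa using this.tendsto ξ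
  exact squeeze_zero (fun _ => norm_nonneg _)
    (fun ξ' => Real.le_sqrt_of_sq_le (norm_featureMap_sub_sq_le H hK ξ' ξ)) hlim

end FeatureMap

/-! ### Bounds and parameter dependence of the network features -/

lemma EuclideanSpace.norm_le_of_forall_abs_le {p : ℕ} {m t : ℝ} (hp : (p : ℝ) ≤ m) (ht : 0 ≤ t)
    {v : Vec p} (hv : ∀ i, |v i| ≤ t) : ‖v‖ ≤ t * m := by
  rw [EuclideanSpace.norm_eq]
  have hm : 0 ≤ m := (Nat.cast_nonneg p).trans hp
  apply Real.sqrt_le_iff.2 ⟨by positivity, ?_⟩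
  have hpp : (p : ℝ) ≤ (p : ℝ) ^ 2 := by
    exact_mod_cast Nat.le_self_pow (two_ne_zero) p
  calc ∑ i, ‖v i‖ ^ 2 ≤ ∑ _i : Fin p, t ^ 2 := by
        gcongr with i
        exact hv i
    _ = p * t ^ 2 := by simp
    _ ≤ m ^ 2 * t ^ 2 := by
        gcongr
        exact hpp.trans (by gcongr)
    _ = (t * m) ^ 2 := by ring

lemma norm_toLp_mulVec_le {p q : ℕ} {m t : ℝ} (hp : (p : ℝ) ≤ m) (hq : (q : ℝ) ≤ m)
    {M : Matrix (Fin p) (Fin q) ℝ} (hM : ∀ i j, |M i j| ≤ t) (ht : 0 ≤ t) (v : Vec q) :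
    ‖(WithLp.toLp 2 (M.mulVec v.ofLp) : Vec p)‖ ≤ t * m * ‖v‖ := by
  have hm : 0 ≤ m := (Nat.cast_nonneg p).trans hp
  rw [EuclideanSpace.norm_eq]
  apply Real.sqrt_le_iff.2 ⟨by positivity, ?_⟩
  have hrow : ∀ i, (M.mulVec v.ofLp i) ^ 2 ≤ q * t ^ 2 * ‖v‖ ^ 2 := by
    intro i
    calc (M.mulVec v.ofLp i) ^ 2 ≤ (∑ j, M i j ^ 2) * ∑ j, v j ^ 2 :=
          Finset.sum_mul_sq_le_sq_mul_sq Finset.univ (M i) v.ofLp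
      _ ≤ (∑ _j : Fin q, t ^ 2) * ∑ j, v j ^ 2 := by
          gcongr ?_ * _
          refine Finset.sum_le_sum fun j _ => ?_
          rw [← sq_abs]
          gcongr
          exact hM i j
      _ = _ := by
          rw [EuclideanSpace.norm_sq_eq]
          simp
  calc ∑ i, ‖(WithLp.toLp 2 (M.mulVec v.ofLp) : Vec p) i‖ ^ 2
      ≤ ∑ _i : Fin p, q * t ^ 2 * ‖v‖ ^ 2 := by
        refine Finset.sum_le_sum fun i _ => ?_
        simpa using hrow i
    _ = (p * q) * t ^ 2 * ‖v‖ ^ 2 := by simp; ring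
    _ ≤ (m * m) * t ^ 2 * ‖v‖ ^ 2 := by gcongr
    _ = _ := by ring

namespace NetParams

section Features

variable {dims : ℕ → ℕ} {act : ∀ l, Vec (dims l) → Vec (dims l)} {L : ℕ}
  {Ax AΘ Lη Aη Aop m D : ℝ}

/-- The norms of the hidden features grow at most geometrically with the depth. -/
lemma norm_feature_le (hAΘ : 0 ≤ AΘ) (hAη : 0 ≤ Aη) (hAop : 0 ≤ Aop)
    (hdims : ∀ l ≤ L, (dims l : ℝ) ≤ m)
    (hact : ∀ l, 1 ≤ l → l < L →
      (∀ u i, |act l u i| ≤ Aη) ∨ (∀ u, ‖act l u‖ ≤ Aop * ‖u‖))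
    (hD1 : Ax + 1 ≤ D) (hD2 : Aη * m + 1 ≤ D) (hD3 : Aop * (AΘ * m) + 1 ≤ D)
    {θ : NetParams dims} (hθ : θ.BoundedBy L AΘ) {x : Vec (dims 0)} (hx : ‖x‖ ≤ Ax) :
    ∀ l < L, ‖θ.feature act l x‖ + 1 ≤ D ^ (l + 1) := by
  have hm : 0 ≤ m := (Nat.cast_nonneg _).trans (hdims 0 (Nat.zero_le _))
  have hD : 1 ≤ D := by
    have : 0 ≤ Aη * m := by positivity
    linarith
  intro l
  induction l with
  | zero =>
    intro _
    simp only [feature, zero_add, pow_one]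
    linarith
  | succ l ih =>
    intro hl
    have ihl := ih (by omega)
    have hM : 1 ≤ ‖θ.feature act l x‖ + 1 := by linarith [norm_nonneg (θ.feature act l x)]
    set M := ‖θ.feature act l x‖ + 1 with hMdef
    have hstep : ‖θ.feature act (l + 1) x‖ + 1 ≤ D * M := by
      rw [feature]
      rcases hact (l + 1) (by omega) hl with h | h
      · have := EuclideanSpace.norm_le_of_forall_abs_le (hdims (l + 1) hl.le) hAη
          (h (WithLp.toLp 2 ((θ.W l).mulVec (θ.feature act l x).ofLp) + θ.b l))
        nlinarith
      · refine (add_le_add_left (h _) 1).trans ?_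
        have hW := norm_toLp_mulVec_le (hdims (l + 1) hl.le) (hdims l (by omega))
          (fun i j => (hθ l (by omega) i).1 j) hAΘ (θ.feature act l x)
        have hb := EuclideanSpace.norm_le_of_forall_abs_le (hdims (l + 1) hl.le) hAΘ
          (fun i => (hθ l (by omega) i).2)
        calc Aop * ‖WithLp.toLp 2 ((θ.W l).mulVec (θ.feature act l x).ofLp) + θ.b l‖ + 1
            ≤ Aop * (AΘ * m * ‖θ.feature act l x‖ + AΘ * m) + 1 := by
              gcongr
              exact (norm_add_le _ _).trans (add_le_add hW hb)
          _ = (Aop * (AΘ * m)) * M + 1 := by rw [hMdef]; ring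
          _ ≤ (Aop * (AΘ * m)) * M + M := by gcongr
          _ = (Aop * (AΘ * m) + 1) * M := by ring
          _ ≤ D * M := by gcongr
    calc _ ≤ D * M := hstep
      _ ≤ D * D ^ (l + 1) := by gcongr
      _ = D ^ (l + 1 + 1) := by ring

/-- The features depend on the parameters in a Lipschitz way, with a constant that is exponential
in the depth. The hidden features enter only through the bound `D ^ (l + 1)`. -/
lemma norm_feature_sub_le (hAΘ : 0 ≤ AΘ) (hLη : 0 ≤ Lη)
    (hdims : ∀ l ≤ L, (dims l : ℝ) ≤ m)
    (hlip : ∀ l, 1 ≤ l → l ≤ L → ∀ u v, ‖act l u - act l v‖ ≤ Lη * ‖u - v‖)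
    (hD1 : Lη * m ≤ D) (hD2 : Lη * (AΘ * m) ≤ D)
    {θ θ' : NetParams dims} (hθ' : θ'.BoundedBy L AΘ) {x : Vec (dims 0)}
    (hfeat : ∀ l < L, ‖θ.feature act l x‖ + 1 ≤ D ^ (l + 1))
    {τ : ℝ} (hτ : 0 ≤ τ)
    (hclose : ∀ l < L, ∀ i, (∀ j, |θ.W l i j - θ'.W l i j| ≤ τ) ∧ |θ.b l i - θ'.b l i| ≤ τ) :
    ∀ l ≤ L, ‖θ.feature act l x - θ'.feature act l x‖ ≤ τ * l * D ^ (l + 1) := by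
  have hm : 0 ≤ m := (Nat.cast_nonneg _).trans (hdims 0 (Nat.zero_le _))
  have hD : 0 ≤ D := (by positivity : 0 ≤ Lη * m).trans hD1
  intro l
  induction l with
  | zero => simp [feature]
  | succ l ih =>
    intro hl
    have ihl := ih (by omega)
    have hf := hfeat l (by omega)
    set ξ := θ.feature act l x with hξ
    set ξ' := θ'.feature act l x with hξ'
    have hsplit : (WithLp.toLp 2 ((θ.W l).mulVec ξ.ofLp) + θ.b l)
        - (WithLp.toLp 2 ((θ'.W l).mulVec ξ'.ofLp) + θ'.b l)
        = WithLp.toLp 2 ((θ.W l - θ'.W l).mulVec ξ.ofLp)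
          + WithLp.toLp 2 ((θ'.W l).mulVec (ξ - ξ').ofLp) + (θ.b l - θ'.b l) := by
      ext i
      simp [Matrix.sub_mulVec, Matrix.mulVec_sub]
      ring
    have h1 := norm_toLp_mulVec_le (hdims (l + 1) hl) (hdims l (by omega))
      (M := θ.W l - θ'.W l) (fun i j => (hclose l (by omega) i).1 j) hτ ξ
    have h2 := norm_toLp_mulVec_le (hdims (l + 1) hl) (hdims l (by omega))
      (fun i j => (hθ' l (by omega) i).1 j) hAΘ (ξ - ξ')
    have h3 := EuclideanSpace.norm_le_of_forall_abs_le (v := θ.b l - θ'.b l) (hdims (l + 1) hl) hτ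
      (fun i => (hclose l (by omega) i).2)
    have hstep : ‖θ.feature act (l + 1) x - θ'.feature act (l + 1) x‖
        ≤ D * (τ * (‖ξ‖ + 1)) + D * ‖ξ - ξ'‖ := by
      rw [feature, feature, ← hξ, ← hξ']
      calc _ ≤ Lη * ‖(WithLp.toLp 2 ((θ.W l).mulVec ξ.ofLp) + θ.b l)
              - (WithLp.toLp 2 ((θ'.W l).mulVec ξ'.ofLp) + θ'.b l)‖ :=
            hlip (l + 1) (by omega) hl _ _
        _ ≤ Lη * (τ * m * ‖ξ‖ + AΘ * m * ‖ξ - ξ'‖ + τ * m) := by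
            rw [hsplit]
            gcongr
            exact norm_add₃_le.trans (add_le_add (add_le_add h1 h2) h3)
        _ = (Lη * m) * (τ * (‖ξ‖ + 1)) + (Lη * (AΘ * m)) * ‖ξ - ξ'‖ := by ring
        _ ≤ _ := by gcongr
    calc _ ≤ D * (τ * (‖ξ‖ + 1)) + D * ‖ξ - ξ'‖ := hstep
      _ ≤ D * (τ * D ^ (l + 1)) + D * (τ * l * D ^ (l + 1)) := by gcongr
      _ = _ := by push_cast; ring

lemma continuous_feature
    (hlip : ∀ l, 1 ≤ l → l ≤ L → ∀ u v, ‖act l u - act l v‖ ≤ Lη * ‖u - v‖)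
    (θ : NetParams dims) : ∀ l ≤ L, Continuous (θ.feature act l) := by
  intro l
  induction l with
  | zero => exact fun _ => continuous_id
  | succ l ih =>
    intro hl
    have hact : Continuous (act (l + 1)) := by
      have : LipschitzWith (Real.toNNReal Lη) (act (l + 1)) :=
        LipschitzWith.of_dist_le' fun u v => by
          simpa [dist_eq_norm] using hlip (l + 1) (by omega) hl u v
      exact this.continuous
    have := ih (by omega)
    refine hact.comp (Continuous.add ?_ continuous_const)
    apply (PiLp.continuous_toLp 2 _).comp
    apply Continuous.matrix_mulVec continuous_const
    exact (PiLp.continuous_ofLp 2 _).comp this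

end Features

end NetParams

section Transform

variable {dims : ℕ → ℕ} {act : ∀ l, Vec (dims l) → Vec (dims l)} {L : ℕ}
  (H : ℕ → Type*) [∀ l, NormedAddCommGroup (H l)]
  [∀ l, InnerProductSpace ℝ (H l)] [∀ l, CompleteSpace (H l)]
  [∀ l, RKHS ℝ (H l) (Vec (dims l)) ℝ]

lemma continuous_transform {Lη Lk A : ℝ}
    (hlip : ∀ l, 1 ≤ l → l ≤ L → ∀ u v, ‖act l u - act l v‖ ≤ Lη * ‖u - v‖)
    (hker : ∀ l, 1 ≤ l → l < L → ∀ ξ₁ ξ₂ ξ : Vec (dims l),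
      |kernelFun (H l) ξ₁ ξ - kernelFun (H l) ξ₂ ξ| ≤ Lk * ‖ξ₁ - ξ₂‖)
    (θ : NetParams dims) : Continuous (transform H act L (A := A) θ) := by
  apply (PiLp.continuous_toLp 2 _).comp
  refine continuous_pi fun l => ?_
  have hl := l.2
  exact (continuous_featureMap (H (l + 1)) (hker (l + 1) (by omega) (by omega))).comp
    ((θ.continuous_feature hlip (l + 1) (by omega)).comp continuous_subtype_val)

lemma norm_transform_sub_sq_le {Lk A : ℝ} (hLk : 0 ≤ Lk)
    (hker : ∀ l, 1 ≤ l → l < L → ∀ ξ₁ ξ₂ ξ : Vec (dims l),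
      |kernelFun (H l) ξ₁ ξ - kernelFun (H l) ξ₂ ξ| ≤ Lk * ‖ξ₁ - ξ₂‖)
    {θ θ' : NetParams dims} {x : InputBall (dims 0) A} {Δ : ℝ} (hΔ0 : 0 ≤ Δ)
    (hΔ : ∀ l ≤ L, ‖θ.feature act l x - θ'.feature act l x‖ ≤ Δ) :
    ‖transform H act L θ x - transform H act L θ' x‖ ^ 2 ≤ L * (2 * Lk * Δ) := by
  rw [PiLp.norm_sq_eq_of_L2]
  calc _ ≤ ∑ _l : Fin (L - 1), 2 * Lk * Δ := by
        refine Finset.sum_le_sum fun l _ => ?_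
        have hl := l.2
        refine (norm_featureMap_sub_sq_le (H (l + 1))
          (hker (l + 1) (by omega) (by omega)) _ _).trans ?_
        gcongr
        exact hΔ (l + 1) (by omega)
    _ = ((L - 1 : ℕ) : ℝ) * (2 * Lk * Δ) := by simp
    _ ≤ _ := by
        gcongr
        exact Nat.sub_le _ _

end Transform

/-! ### A finite net of network parameters -/

/-- The equidistant points of `[-B, B]` with spacing `2 B / n`. -/
noncomputable def gridPoint (B : ℝ) (n : ℕ) (k : Fin (n + 1)) : ℝ := -B + 2 * B / n * k

lemma abs_gridPoint_le {B : ℝ} (hB : 0 ≤ B) {n : ℕ} (hn : 0 < n) (k : Fin (n + 1)) :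
    |gridPoint B n k| ≤ B := by
  have hn' : (0 : ℝ) < n := by exact_mod_cast hn
  have hk : (k : ℝ) ≤ n := by exact_mod_cast Nat.lt_succ_iff.1 k.2
  have h1 : 0 ≤ 2 * B / n * k := by positivity
  have h2 : 2 * B / n * k ≤ 2 * B / n * n := by gcongr
  rw [div_mul_cancel₀ _ hn'.ne'] at h2
  rw [gridPoint, abs_le]
  constructor <;> linarith

lemma exists_abs_sub_gridPoint_le {B : ℝ} (hB : 0 < B) {n : ℕ} (hn : 0 < n) {x : ℝ}
    (hx : |x| ≤ B) : ∃ k, |x - gridPoint B n k| ≤ 2 * B / n := by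
  have hn' : (0 : ℝ) < n := by exact_mod_cast hn
  obtain ⟨h1, h2⟩ := abs_le.1 hx
  have hs : 0 < 2 * B / n := by positivity
  have ht0 : 0 ≤ (x + B) / (2 * B / n) := div_nonneg (by linarith) hs.le
  have hk : ⌊(x + B) / (2 * B / n)⌋₊ < n + 1 := by
    rw [Nat.lt_succ_iff]
    apply Nat.floor_le_of_le
    rw [div_le_iff₀ hs, mul_div_cancel₀ _ hn'.ne']
    linarith
  refine ⟨⟨_, hk⟩, ?_⟩
  have h3 := Nat.floor_le ht0
  have h4 := (Nat.lt_floor_add_one ((x + B) / (2 * B / n))).le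
  rw [le_div_iff₀ hs] at h3
  rw [div_le_iff₀ hs] at h4
  rw [gridPoint, abs_le]
  constructor <;> simp only <;> linarith

/-- The positions of the parameters of the layers `1, …, L`; `none` is the position of a bias. -/
abbrev ParamIndex (dims : ℕ → ℕ) (L : ℕ) : Type :=
  Σ l : Fin L, Fin (dims (l + 1)) × Option (Fin (dims l))

/-- The network whose parameters in the layers `1, …, L` are the grid points with the given
indices, all other parameters being `0`. -/
noncomputable def gridParams {dims : ℕ → ℕ} {L : ℕ} (B : ℝ) (n : ℕ)
    (c : ParamIndex dims L → Fin (n + 1)) : NetParams dims where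
  W l i j := if h : l < L then gridPoint B n (c ⟨⟨l, h⟩, i, some j⟩) else 0
  b l := WithLp.toLp 2 fun i => if h : l < L then gridPoint B n (c ⟨⟨l, h⟩, i, none⟩) else 0

lemma gridParams_boundedBy {dims : ℕ → ℕ} {L : ℕ} {B : ℝ} (hB : 0 ≤ B) {n : ℕ} (hn : 0 < n)
    (c : ParamIndex dims L → Fin (n + 1)) : (gridParams B n c).BoundedBy L B := by
  intro l hl i
  simp only [gridParams, hl, dif_pos]
  exact ⟨fun j => abs_gridPoint_le hB hn _, abs_gridPoint_le hB hn _⟩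

lemma exists_gridParams_close {dims : ℕ → ℕ} {L : ℕ} {B : ℝ} (hB : 0 < B) {n : ℕ} (hn : 0 < n)
    {θ : NetParams dims} (hθ : θ.BoundedBy L B) :
    ∃ c : ParamIndex dims L → Fin (n + 1), ∀ l < L, ∀ i,
      (∀ j, |θ.W l i j - (gridParams B n c).W l i j| ≤ 2 * B / n) ∧
        |θ.b l i - (gridParams B n c).b l i| ≤ 2 * B / n := by
  have h : ∀ p : ParamIndex dims L, ∃ k, |(match p with
      | ⟨l, i, some j⟩ => θ.W l i j
      | ⟨l, i, none⟩ => θ.b l i) - gridPoint B n k| ≤ 2 * B / n := by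
    rintro ⟨l, i, _ | j⟩
    · exact exists_abs_sub_gridPoint_le hB hn (hθ l l.2 i).2
    · exact exists_abs_sub_gridPoint_le hB hn ((hθ l l.2 i).1 j)
  choose c hc using h
  refine ⟨c, fun l hl i => ⟨fun j => ?_, ?_⟩⟩
  · simpa [gridParams, hl] using hc ⟨⟨l, hl⟩, i, some j⟩
  · simpa [gridParams, hl] using hc ⟨⟨l, hl⟩, i, none⟩

lemma card_paramIndex_le {dims : ℕ → ℕ} {L : ℕ} {m : ℝ} (hdims : ∀ l ≤ L, (dims l : ℝ) ≤ m) :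
    (Fintype.card (ParamIndex dims L) : ℝ) ≤ L * (m * (m + 1)) := by
  have hm : 0 ≤ m := (Nat.cast_nonneg _).trans (hdims 0 (Nat.zero_le _))
  rw [Fintype.card_sigma]
  push_cast
  calc _ ≤ ∑ _l : Fin L, m * (m + 1) := by
        refine Finset.sum_le_sum fun l _ => ?_
        have hl := l.2
        simp only [Fintype.card_prod, Fintype.card_fin, Fintype.card_option]
        push_cast
        gcongr
        · exact hdims _ (by omega)
        · exact hdims _ (by omega)
    _ = _ := by simp

lemma one_half_le_log_natCast {d : ℕ} (hd : 2 ≤ d) : 1 / 2 ≤ Real.log d := by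
  have h1 : Real.log 2 ≤ Real.log d := Real.log_le_log two_pos (by exact_mod_cast hd)
  linarith [Real.log_two_gt_d9]

lemma one_le_complexityRate {L d : ℕ} {ε : ℝ} (hL : 1 ≤ L) (hd : 2 ≤ d) (hε : 0 < ε)
    (hε1 : ε ≤ 1) : 1 ≤ complexityRate L d ε := by
  have hL' : (1 : ℝ) ≤ L := by exact_mod_cast hL
  have hd' : (2 : ℝ) ≤ d := by exact_mod_cast hd
  have hlog := one_half_le_log_natCast hd
  have h1 : 0 ≤ Real.log (L / ε) := Real.log_nonneg ((one_le_div hε).2 (hε1.trans hL'))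
  have h2 : 0 ≤ (d : ℝ) ^ 2 * L * Real.log (L / ε) := by positivity
  have h3 : (2 : ℝ) ^ 2 * (1 : ℝ) ^ 2 * (1 / 2) ≤ (d : ℝ) ^ 2 * (L : ℝ) ^ 2 * Real.log d := by
    gcongr
  rw [complexityRate]
  linarith

/-- The metric entropy of the grid of parameters is at most a constant times `complexityRate`:
the logarithm of the number of grid points is `O(log (L / ε) + L log d)`, and there are
`O(d² L)` parameters. -/
lemma exists_grid_card_le {A G κ δ : ℝ} (hA : 0 < A) (hG : 1 ≤ G) (hκ : 0 < κ) (hδ : 0 < δ) :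
    ∃ K : ℝ, 0 < K ∧ ∀ (L d p : ℕ) (ε : ℝ), 1 ≤ L → 2 ≤ d → 0 < ε → ε ≤ 1 →
      (p : ℝ) ≤ L * (κ * d * (κ * d + 1)) →
      2 * ((⌈A * (L : ℝ) ^ 2 * (G * d) ^ (L + 1) / ε ^ 2⌉₊ : ℝ) + 1) ^ p
        ≤ δ / 4 * Real.exp (K * complexityRate L d ε) := by
  set a := Real.log (A + 2)
  set g := Real.log G
  have ha : 0 ≤ a := Real.log_nonneg (by linarith)
  have hg : 0 ≤ g := Real.log_nonneg hG
  set K₁ := 2 * a + 4 * g + 2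
  have hK₁ : 0 < K₁ := by positivity
  refine ⟨κ * (κ + 1) * K₁ + |Real.log (8 / δ)|, by positivity, ?_⟩
  intro L d p ε hL hd hε hε1 hp
  have hρ := one_le_complexityRate hL hd hε hε1
  set ρ := complexityRate L d ε with hρdef
  have hL' : (1 : ℝ) ≤ L := by exact_mod_cast hL
  have hd' : (2 : ℝ) ≤ d := by exact_mod_cast hd
  have hlogd := one_half_le_log_natCast hd
  have hℓ : 0 ≤ Real.log (L / ε) := Real.log_nonneg ((one_le_div hε).2 (hε1.trans hL'))
  set ℓ := Real.log (L / ε) with hℓdef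
  set s := L * Real.log d with hs
  have hLs : (L : ℝ) ≤ 2 * s := by rw [hs]; nlinarith
  have hρs : ρ = d ^ 2 * L * (ℓ + s) := by
    rw [hρdef, complexityRate, hs]; ring
  have hGd : 1 ≤ G * d := by nlinarith
  set Q := (L : ℝ) ^ 2 * (G * d) ^ (L + 1) / ε ^ 2 with hQ
  have hQ1 : 1 ≤ Q := by
    rw [hQ, one_le_div (by positivity)]
    calc ε ^ 2 ≤ 1 := pow_le_one₀ hε.le hε1
      _ ≤ _ := one_le_mul_of_one_le_of_one_le (one_le_pow₀ hL') (one_le_pow₀ hGd)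
  have hn : (⌈A * (L : ℝ) ^ 2 * (G * d) ^ (L + 1) / ε ^ 2⌉₊ : ℝ) + 1 ≤ (A + 2) * Q := by
    have h1 : A * (L : ℝ) ^ 2 * (G * d) ^ (L + 1) / ε ^ 2 = A * Q := by rw [hQ]; ring
    rw [h1]
    have h2 := (Nat.ceil_lt_add_one (a := A * Q) (by positivity)).le
    linarith
  have hlogQ : Real.log ((A + 2) * Q) ≤ K₁ * (ℓ + s) := by
    have hQ2 : Q = (L / ε) ^ 2 * (G * d) ^ (L + 1) := by rw [hQ]; ring
    rw [Real.log_mul (by positivity) (by positivity), hQ2,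
      Real.log_mul (by positivity) (by positivity), Real.log_pow, Real.log_pow,
      Real.log_mul (by positivity) (by positivity)]
    change a + (((2 : ℕ) : ℝ) * ℓ + ((L + 1 : ℕ) : ℝ) * (g + Real.log d)) ≤ K₁ * (ℓ + s)
    push_cast
    have e1 : ((L : ℝ) + 1) * (g + Real.log d) ≤ (2 * L) * (g + Real.log d) := by
      gcongr
      linarith
    have e2 : (2 * L) * (g + Real.log d) ≤ 2 * (2 * s) * g + 2 * s := by
      have : (L : ℝ) * g ≤ 2 * s * g := by gcongr
      rw [hs] at this ⊢
      linarith
    have e3 : a ≤ 2 * a * s := by nlinarith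
    have e4 : 0 ≤ (2 * a + 4 * g) * ℓ := by positivity
    simp only [K₁]
    linarith
  have hp2 : (p : ℝ) ≤ κ * (κ + 1) * (d ^ 2 * L) := by
    calc (p : ℝ) ≤ L * (κ * d * (κ * d + 1)) := hp
      _ ≤ L * (κ * d * (κ * d + d)) := by gcongr; linarith
      _ = _ := by ring
  have hpow : ((⌈A * (L : ℝ) ^ 2 * (G * d) ^ (L + 1) / ε ^ 2⌉₊ : ℝ) + 1) ^ p
      ≤ Real.exp (κ * (κ + 1) * K₁ * ρ) := by
    calc _ ≤ ((A + 2) * Q) ^ p := by gcongr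
      _ = Real.exp (p * Real.log ((A + 2) * Q)) := by
          rw [Real.exp_nat_mul, Real.exp_log (by positivity)]
      _ ≤ Real.exp ((κ * (κ + 1) * (d ^ 2 * L)) * (K₁ * (ℓ + s))) := by
          have : 0 ≤ Real.log ((A + 2) * Q) := Real.log_nonneg (by nlinarith)
          gcongr
      _ = _ := by rw [hρs]; ring_nf
  have hδ2 : 2 ≤ δ / 4 * Real.exp (|Real.log (8 / δ)| * ρ) := by
    have h1 : Real.log (8 / δ) ≤ |Real.log (8 / δ)| * ρ :=
      (le_abs_self _).trans (le_mul_of_one_le_right (abs_nonneg _) hρ)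
    calc 2 = δ / 4 * Real.exp (Real.log (8 / δ)) := by
          rw [Real.exp_log (by positivity)]
          field_simp
          norm_num
      _ ≤ _ := by gcongr
  calc _ ≤ (δ / 4 * Real.exp (|Real.log (8 / δ)| * ρ)) * Real.exp (κ * (κ + 1) * K₁ * ρ) := by
        gcongr
    _ = _ := by
        rw [mul_assoc, ← Real.exp_add]
        ring_nf

/-- The admissible networks have a finite net whose size is exponential in `complexityRate` and
whose members approximate all feature vectors up to `ε² / (K₀ L)`. The square is needed because
the feature maps of the kernels are only Hölder continuous with exponent `1 / 2`. -/
lemma exists_featureNet {Ax AΘ Lη Aη Aop κ K₀ δ : ℝ} (hAx : 0 < Ax) (hAΘ : 0 < AΘ) (hLη : 0 < Lη)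
    (hAη : 0 < Aη) (hAop : 0 < Aop) (hκ : 0 < κ) (hK₀ : 0 < K₀) (hδ : 0 < δ) :
    ∃ K : ℝ, 0 < K ∧ ∀ (L d : ℕ) (ε : ℝ) (dims : ℕ → ℕ), 1 ≤ L → 2 ≤ d → 0 < ε → ε ≤ 1 →
      (∀ l ≤ L, (dims l : ℝ) ≤ κ * d) →
      ∀ (act : ∀ l, Vec (dims l) → Vec (dims l)),
      (∀ l, 1 ≤ l → l ≤ L → ∀ u v, ‖act l u - act l v‖ ≤ Lη * ‖u - v‖) →
      (∀ l, 1 ≤ l → l < L →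
        (∀ u i, |act l u i| ≤ Aη) ∨ (∀ u, ‖act l u‖ ≤ Aop * ‖u‖)) →
      ∃ (ι : Type) (_ : Fintype ι) (e : ι → NetParams dims), (∀ i, (e i).BoundedBy L AΘ) ∧
        2 * (Fintype.card ι : ℝ) ≤ δ / 4 * Real.exp (K * complexityRate L d ε) ∧
        ∀ θ : NetParams dims, θ.BoundedBy L AΘ → ∃ i, ∀ x : InputBall (dims 0) Ax, ∀ l ≤ L,
          ‖θ.feature act l x - (e i).feature act l x‖ ≤ ε ^ 2 / (K₀ * L) := by
  set G := 1 + Ax + κ * (Aη + Aop * AΘ + Lη + Lη * AΘ) with hG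
  have hG1 : 1 ≤ G := by
    have : 0 ≤ Ax + κ * (Aη + Aop * AΘ + Lη + Lη * AΘ) := by positivity
    linarith
  obtain ⟨K, hK, hcard⟩ := exists_grid_card_le (A := 2 * AΘ * K₀) (by positivity) hG1 hκ hδ
  refine ⟨K, hK, ?_⟩
  intro L d ε dims hL hd hε hε1 hdims act hlip hact
  have hL' : (1 : ℝ) ≤ L := by exact_mod_cast hL
  have hd' : (1 : ℝ) ≤ d := by exact_mod_cast (one_le_two.trans hd)
  set D := G * d with hDdef
  have hD1 : 1 ≤ D := one_le_mul_of_one_le_of_one_le hG1 hd'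
  set X := 2 * AΘ * K₀ * (L : ℝ) ^ 2 * D ^ (L + 1) / ε ^ 2 with hX
  have hX0 : 0 < X := by positivity
  set n := ⌈X⌉₊
  have hn : 0 < n := Nat.ceil_pos.2 hX0
  have hn' : (0 : ℝ) < n := by exact_mod_cast hn
  have hXn : X ≤ n := Nat.le_ceil X
  refine ⟨ParamIndex dims L → Fin (n + 1), inferInstance, gridParams AΘ n,
    gridParams_boundedBy hAΘ.le hn, ?_, ?_⟩
  · have := hcard L d (Fintype.card (ParamIndex dims L)) ε hL hd hε hε1 (card_paramIndex_le hdims)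
    simpa using this
  intro θ hθ
  obtain ⟨c, hc⟩ := exists_gridParams_close hAΘ hn hθ
  refine ⟨c, fun x l hl => ?_⟩
  have hx : ‖(x : Vec (dims 0))‖ ≤ Ax := mem_closedBall_zero_iff.1 x.2
  have hDd : ∀ t : ℝ, 0 ≤ t → 1 + t * κ ≤ G → t * (κ * d) + 1 ≤ D := by
    intro t ht h
    calc t * (κ * d) + 1 ≤ t * (κ * d) + d := by gcongr
      _ = (1 + t * κ) * d := by ring
      _ ≤ D := by rw [hDdef]; gcongr
  have p1 : 0 < Aη * κ := by positivity
  have p2 : 0 < Aop * AΘ * κ := by positivity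
  have p3 : 0 < Lη * κ := by positivity
  have p4 : 0 < Lη * AΘ * κ := by positivity
  have d1 : Ax + 1 ≤ D := by
    rw [hDdef]
    have : Ax + 1 ≤ G := by linarith
    nlinarith
  have d2 : Aη * (κ * d) + 1 ≤ D := hDd Aη hAη.le (by linarith)
  have d3 : Aop * (AΘ * (κ * d)) + 1 ≤ D := by
    rw [← mul_assoc Aop]
    exact hDd _ (by positivity) (by linarith)
  have d4 : Lη * (κ * d) ≤ D := by linarith [hDd Lη hLη.le (by linarith)]
  have d5 : Lη * (AΘ * (κ * d)) ≤ D := by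
    rw [← mul_assoc Lη]
    linarith [hDd (Lη * AΘ) (by positivity) (by linarith)]
  have hfeat := NetParams.norm_feature_le hAΘ.le hAη.le hAop.le hdims hact d1 d2 d3 hθ hx
  have hdiff := NetParams.norm_feature_sub_le hAΘ.le hLη.le hdims hlip d4 d5
    (gridParams_boundedBy hAΘ.le hn c) hfeat (by positivity) hc l hl
  calc _ ≤ 2 * AΘ / n * l * D ^ (l + 1) := hdiff
    _ ≤ 2 * AΘ / X * L * D ^ (L + 1) := by gcongr
    _ = ε ^ 2 / (K₀ * L) := by
        rw [hX]
        field_simp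

/-! ### Generalization bound -/

section UniformLaw

variable {Z E Ω : Type*} [MeasurableSpace Z] [NormedAddCommGroup E] [InnerProductSpace ℝ E]
  [CompleteSpace E] [MeasurableSpace Ω]

/-- The uniform law of large numbers for a class with a net of at most `η / 2 * exp h` members: once
the Bernstein exponent `c n u²` reaches the entropy `h`, the exceptional event has measure at most
`η`. -/
lemma measure_exists_norm_sampleMean_sub_gt_le_of_entropy {P : Measure Ω} [IsProbabilityMeasure P]
    {μ : Measure Z} [IsProbabilityMeasure μ] {n : ℕ} (hn : 0 < n) {X : Fin n → Ω → Z}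
    (hX : ∀ i, Measurable (X i)) (hind : iIndepFun X P) (hlaw : ∀ i, P.map (X i) = μ)
    {Θ ι : Type*} [Fintype ι] {S : Set Θ} {e : ι → Θ} (heS : ∀ i, e i ∈ S) {f : Θ → Z → E}
    (hf : ∀ θ ∈ S, StronglyMeasurable (f θ)) (hB : ∀ θ ∈ S, ∃ B : ℝ, ∀ z, ‖f θ z‖ ≤ B)
    {σ C : ℝ} (hσ : 0 < σ) (hC : 0 < C)
    (hmom : ∀ θ ∈ S, ∀ k : ℕ, 2 ≤ k →
      ∫ z, ‖f θ z - ∫ w, f θ w ∂μ‖ ^ k ∂μ ≤ (k.factorial : ℝ) / 2 * σ ^ 2 * C ^ (k - 2))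
    {u v : ℝ} (hu0 : 0 ≤ u) (hu1 : u ≤ 1) (hv : 0 ≤ v)
    (hnet : ∀ θ ∈ S, ∃ i, ∀ z, ‖f θ z - f (e i) z‖ ≤ v) {η c h : ℝ}
    (hcard : 2 * (Fintype.card ι : ℝ) ≤ η * Real.exp h) (hc : c ≤ bernsteinRate σ C)
    (hsize : h ≤ c * n * u ^ 2) :
    P {ω | ¬ ∀ θ ∈ S, ‖(1 / n : ℝ) • ∑ i, f θ (X i ω) - ∫ z, f θ z ∂μ‖ ≤ u + 2 * v}
      ≤ ENNReal.ofReal η := by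
  refine (measure_exists_norm_sampleMean_sub_gt_le hn hX hind hlaw heS hf hB hσ hC hmom hu0 hu1
    hv hnet).trans (ENNReal.ofReal_le_ofReal ?_)
  have h1 : h ≤ bernsteinRate σ C * n * u ^ 2 := hsize.trans (by gcongr)
  calc (Fintype.card ι : ℝ) * (2 * Real.exp (-(bernsteinRate σ C * n * u ^ 2)))
      ≤ Fintype.card ι * (2 * Real.exp (-h)) := by gcongr
    _ = 2 * Fintype.card ι * Real.exp (-h) := by ring
    _ ≤ η * Real.exp h * Real.exp (-h) := by gcongr
    _ = η := by rw [mul_assoc, ← Real.exp_add, add_neg_cancel, Real.exp_zero, mul_one]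

end UniformLaw

section TargetWeight

variable {α c₁ c₂ A ε ρ M : ℝ}

/-- With few labeled target samples, the weight `α` of the target loss is so small that the trivial
bound `A` on the target deviation suffices. -/
lemma targetWeight_mul_le_of_lt (hA : 0 < A) (hc₁ : 0 ≤ c₁) (hc₂ : 0 < c₂)
    (hcc : c₁ * √c₂ = 1 / (1 + 2 * A)) (hε : 0 < ε) (hρ : 0 < ρ)
    (hα : α ≤ c₁ * √(M * ε ^ 2 / ρ)) (hM : M < c₂ * ρ) : α * A ≤ ε / 2 := by
  have hαle : α ≤ 1 / (1 + 2 * A) * ε := by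
    calc α ≤ c₁ * √(M * ε ^ 2 / ρ) := hα
      _ ≤ c₁ * √(c₂ * ε ^ 2) := by
          gcongr
          rw [div_le_iff₀ hρ]
          nlinarith [sq_nonneg ε]
      _ = 1 / (1 + 2 * A) * ε := by
          rw [Real.sqrt_mul hc₂.le, Real.sqrt_sq hε.le, ← mul_assoc, hcc]
  have hfrac : 1 / (1 + 2 * A) * A ≤ 1 / 2 := by
    rw [div_mul_eq_mul_div, div_le_div_iff₀ (by positivity) two_pos]
    linarith
  calc α * A ≤ (1 / (1 + 2 * A) * ε) * A := by gcongr
    _ = (1 / (1 + 2 * A) * A) * ε := by ring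
    _ ≤ 1 / 2 * ε := by gcongr
    _ = ε / 2 := by ring

/-- The weight `α` compensates the statistical error of the target loss, which is of order
`√(ρ / M)` when there are `M` labeled target samples. -/
lemma targetWeight_mul_sqrt_le (hA : 0 < A) (hc₂ : 0 < c₂)
    (hcc : c₁ * √c₂ = 1 / (1 + 2 * A)) (hε : 0 < ε) (hρ : 0 < ρ) (hM : 0 < M)
    (hα : α ≤ c₁ * √(M * ε ^ 2 / ρ)) : α * √(c₂ * ρ / (16 * M)) ≤ ε / 4 := by
  have hfrac : 1 / (1 + 2 * A) ≤ 1 := (div_le_one (by positivity)).2 (by linarith)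
  calc α * √(c₂ * ρ / (16 * M)) ≤ c₁ * √(M * ε ^ 2 / ρ) * √(c₂ * ρ / (16 * M)) := by gcongr
    _ = c₁ * √((M * ε ^ 2 / ρ) * (c₂ * ρ / (16 * M))) := by
        rw [Real.sqrt_mul (by positivity), mul_assoc]
    _ = c₁ * √(c₂ * (ε / 4) ^ 2) := by
        congr 2
        field_simp
        norm_num
    _ = 1 / (1 + 2 * A) * (ε / 4) := by
        rw [Real.sqrt_mul hc₂.le, Real.sqrt_sq (by positivity), ← mul_assoc, hcc]
    _ ≤ 1 * (ε / 4) := by gcongr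
    _ = ε / 4 := one_mul _

/-- The weighted uniform law for the target loss, for any number `n` of labeled samples: a class of
functions with values in `[0, A]` deviates by at most `ε / 2` after multiplication with `α`. -/
lemma exists_measure_le_targetWeight_mul_sub_le {Z Ω : Type*} [MeasurableSpace Z]
    [MeasurableSpace Ω] {P : Measure Ω} [IsProbabilityMeasure P]
    {μ : Measure Z} [IsProbabilityMeasure μ] {n : ℕ} {X : Fin n → Ω → Z}
    (hX : ∀ i, Measurable (X i)) (hind : iIndepFun X P) (hlaw : ∀ i, P.map (X i) = μ)
    {Θ ι : Type*} [Fintype ι] {S : Set Θ} {e : ι → Θ} (heS : ∀ i, e i ∈ S) {f : Θ → Z → ℝ}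
    (hf : ∀ θ ∈ S, StronglyMeasurable (f θ)) (hfA : ∀ θ ∈ S, ∀ z, 0 ≤ f θ z ∧ f θ z ≤ A)
    (hnet : ∀ θ ∈ S, ∃ i, ∀ z, ‖f θ z - f (e i) z‖ ≤ ε / 8) {η c : ℝ}
    (hcard : 2 * (Fintype.card ι : ℝ) ≤ η * Real.exp (c * c₂ / 16 * ρ))
    (hc : c ≤ bernsteinRate A A) (hA : 0 < A) (hc₁ : 0 ≤ c₁) (hc₂ : 0 < c₂)
    (hcc : c₁ * √c₂ = 1 / (1 + 2 * A)) (hε : 0 < ε) (hρ : 0 < ρ)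
    (hα0 : 0 ≤ α) (hα1 : α ≤ 1) (hα : α ≤ c₁ * √(n * ε ^ 2 / ρ)) :
    ∃ B : Set Ω, P B ≤ ENNReal.ofReal η ∧ ∀ ω ∉ B, ∀ θ ∈ S,
      α * (∫ z, f θ z ∂μ - (1 / n : ℝ) * ∑ i, f θ (X i ω)) ≤ ε / 2 := by
  rcases lt_or_ge (n : ℝ) (c₂ * ρ) with hn | hn
  · refine ⟨∅, by simp, fun ω _ θ hθ => ?_⟩
    have hexp : ∫ z, f θ z ∂μ ≤ A := by
      calc ∫ z, f θ z ∂μ ≤ ∫ _z, A ∂μ :=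
            integral_mono_of_nonneg (ae_of_all _ fun z => (hfA θ hθ z).1) (integrable_const _)
              (ae_of_all _ fun z => (hfA θ hθ z).2)
        _ = A := by simp
    have hemp : 0 ≤ (1 / n : ℝ) * ∑ i, f θ (X i ω) :=
      mul_nonneg (by positivity) (Finset.sum_nonneg fun i _ => (hfA θ hθ _).1)
    refine le_trans ?_ (targetWeight_mul_le_of_lt hA hc₁ hc₂ hcc hε hρ hα hn)
    exact mul_le_mul_of_nonneg_left (by linarith) hα0
  · have hn0 : (0 : ℝ) < n := lt_of_lt_of_le (by positivity) hn
    set u := √(c₂ * ρ / (16 * n)) with hu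
    have hu2 : u ^ 2 = c₂ * ρ / (16 * n) := Real.sq_sqrt (by positivity)
    have hu1 : u ≤ 1 := by
      rw [hu, Real.sqrt_le_one, div_le_one (by positivity)]
      linarith
    have hb := measure_exists_norm_sampleMean_sub_gt_le_of_entropy (by exact_mod_cast hn0)
      hX hind hlaw heS hf
      (fun θ hθ => ⟨A, fun z => by rw [Real.norm_of_nonneg (hfA θ hθ z).1]; exact (hfA θ hθ z).2⟩)
      hA hA (fun θ hθ => moments_le_of_mem_Icc (hf θ hθ) hA (hfA θ hθ))
      (Real.sqrt_nonneg _) hu1 (by positivity) hnet hcard hc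
      (by rw [← hu, hu2]; apply le_of_eq; field_simp)
    refine ⟨_, hb, fun ω hω θ hθ => ?_⟩
    simp only [Set.mem_ofPred_eq, not_not] at hω
    have hαu : α * u ≤ ε / 4 := targetWeight_mul_sqrt_le hA hc₂ hcc hε hρ hn0 hα
    have h1 := (neg_le_abs _).trans (hω θ hθ)
    rw [neg_sub, smul_eq_mul] at h1
    calc _ ≤ α * (u + 2 * (ε / 8)) := by gcongr
      _ = α * u + α * (ε / 4) := by ring
      _ ≤ ε / 4 + 1 * (ε / 4) := by gcongr
      _ = ε / 2 := by ring

end TargetWeight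

/-- The deterministic step: the bound on the target loss follows from the domain adaptation
inequality and the deviation bounds of the empirical quantities. -/
lemma le_of_deviation_le {lt ls elt els D D' α R ε : ℝ} (hα : α ≤ 1) (hR : 0 ≤ R) (hε : 0 ≤ ε)
    (hα0 : 0 ≤ α)
    (hadapt : |ls - lt| ≤ R * D) (hD : D ≤ D' + ε) (hls : ls ≤ els + ε / 2)
    (hlt : α * (lt - elt) ≤ ε / 2) :
    lt ≤ ((1 - α) * els + α * elt) + (1 - α) * R * D' + (1 - α) * R * ε + ε := by
  have h1 : lt ≤ els + ε / 2 + R * (D' + ε) := by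
    have := (abs_le.1 hadapt).1
    have : R * D ≤ R * (D' + ε) := by gcongr
    linarith
  have h2 : (1 - α) * lt ≤ (1 - α) * (els + ε / 2 + R * (D' + ε)) :=
    mul_le_mul_of_nonneg_left h1 (by linarith)
  have h3 : (1 - α) * (ε / 2) ≤ ε / 2 := mul_le_of_le_one_left (by linarith) (by linarith)
  linarith

/-- The empirical maximum mean discrepancy deviates from the population quantity by at most the
sum of the deviations of the two sample means. -/
lemma mmd_le_empMMD_add {X X' V E : Type*} [MeasurableSpace X] [MeasurableSpace X']
    [MeasurableSpace V] {Y : Set V} [NormedAddCommGroup E] [NormedSpace ℝ E]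
    {μ : Measure (X × Y)} {ν : Measure (X' × Y)} {f : X → E} {f' : X' → E} {N N' : ℕ}
    {z : Fin N → X × Y} {z' : Fin N' → X' × Y} {a b : ℝ}
    (h : ‖(1 / N : ℝ) • ∑ i, f (z i).1 - ∫ w, f w.1 ∂μ‖ ≤ a)
    (h' : ‖(1 / N' : ℝ) • ∑ i, f' (z' i).1 - ∫ w, f' w.1 ∂ν‖ ≤ b) :
    mmd μ ν f f' ≤ empMMD z z' f f' + (a + b) := by
  have key : ∀ p q p' q' : E, ‖p - q‖ ≤ ‖p' - q'‖ + (‖p' - p‖ + ‖q' - q‖) := by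
    intro p q p' q'
    have h1 := norm_add_le (p' - q') (-(p' - p) + (q' - q))
    have h2 := norm_add_le (-(p' - p)) (q' - q)
    rw [norm_neg] at h2
    have h3 : p' - q' + (-(p' - p) + (q' - q)) = p - q := by abel
    rw [h3] at h1
    linarith
  exact (key _ _ _ _).trans (by rw [empMMD]; gcongr)

theorem mainTheorem3
    -- the fixed constants: input radius, parameter bound, Lipschitz constants of kernels and
    -- activations, bounds of the activations, bound and Lipschitz constant of the loss,
    -- moment constants, width factor, failure probability
    (Ax AΘ Lk Lη Aη Aop Aℓ Lℓ σs σt Cs Ct κ δ : ℝ)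
    (hAx : 0 < Ax) (hAΘ : 0 < AΘ) (hLk : 0 < Lk) (hLη : 0 < Lη) (hAη : 0 < Aη) (hAop : 0 < Aop)
    (hAℓ : 0 < Aℓ) (hLℓ : 0 < Lℓ) (hσs : 0 < σs) (hσt : 0 < σt) (hCs : 0 < Cs) (hCt : 0 < Ct)
    (hκ : 0 < κ) (hδ : 0 < δ) :
    ∃ c₁ : ℝ, 0 < c₁ ∧ ∃ c₂ : ℝ, 0 < c₂ ∧
    -- depth, width parameter, accuracy and layer widths
    ∀ (L d : ℕ) (ε : ℝ) (dims : ℕ → ℕ), 1 ≤ L → 2 ≤ d → 0 < ε → ε ≤ 1 →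
    (∀ l ≤ L, (dims l : ℝ) ≤ κ * d) →
    -- activation functions
    ∀ (act : ∀ l, Vec (dims l) → Vec (dims l)),
    (∀ l, 1 ≤ l → l ≤ L → ∀ u v, ‖act l u - act l v‖ ≤ Lη * ‖u - v‖) →
    (∀ l, 1 ≤ l → l < L →
      (∀ u i, |act l u i| ≤ Aη) ∨ (∀ u, ‖act l u‖ ≤ Aop * ‖u‖)) →
    -- reproducing kernel Hilbert spaces of the layers, with Lipschitz kernels
    ∀ (H : ℕ → Type*) [∀ l, NormedAddCommGroup (H l)] [∀ l, InnerProductSpace ℝ (H l)]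
      [∀ l, CompleteSpace (H l)] [∀ l, RKHS ℝ (H l) (Vec (dims l)) ℝ],
    (∀ l, 1 ≤ l → l < L → ∀ ξ₁ ξ₂ ξ : Vec (dims l),
      |kernelFun (H l) ξ₁ ξ - kernelFun (H l) ξ₂ ξ| ≤ Lk * ‖ξ₁ - ξ₂‖) →
    -- label set, containing the network outputs, and loss function
    ∀ (Y : Set (Vec (dims L))),
    (∀ θ : NetParams dims, θ.BoundedBy L AΘ →
      ∀ x : InputBall (dims 0) Ax, output act L θ x ∈ Y) →
    ∀ (loss : Vec (dims L) → Vec (dims L) → ℝ),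
    Measurable (fun p : Y × Y => loss p.1 p.2) →
    (∀ y₁ ∈ Y, ∀ y₂ ∈ Y, 0 ≤ loss y₁ y₂ ∧ loss y₁ y₂ ≤ Aℓ) →
    (∀ y₁ ∈ Y, ∀ y₂ ∈ Y, ∀ y ∈ Y, |loss y₁ y - loss y₂ y| ≤ Lℓ * ‖y₁ - y₂‖) →
    -- source and target distributions
    ∀ (μs μt : Measure (InputBall (dims 0) Ax × Y)) [IsProbabilityMeasure μs]
      [IsProbabilityMeasure μt],
    (∀ θ : NetParams dims, θ.BoundedBy L AΘ →
      BernsteinMoments μs (transform H act L θ) σs Cs ∧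
      BernsteinMoments μt (transform H act L θ) σt Ct) →
    ∀ (R : ℝ), 0 < R →
    (∀ θs θt : NetParams dims, θs.BoundedBy L AΘ → θt.BoundedBy L AΘ → θs.ShareLayer θt L →
      |expLoss loss μs (output act L θs) - expLoss loss μt (output act L θt)| ≤
        R * mmd μs μt (transform H act L θs) (transform H act L θt)) →
    -- sample sizes and weight parameter
    ∀ (Ms Mt Ns Nt : ℕ) (hs : Ms ≤ Ns) (ht : Mt ≤ Nt) (α : ℝ), 0 ≤ α → α ≤ 1 →
    α ≤ c₁ * Real.sqrt (Mt * ε ^ 2 / complexityRate L d ε) →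
    c₂ * (complexityRate L d ε / ε ^ 2) ≤ Ms →
    c₂ * (complexityRate L d ε / ε ^ 2) ≤ Ns →
    c₂ * (complexityRate L d ε / ε ^ 2) ≤ Nt →
    -- independent samples
    ∀ (Ω : Type*) [MeasurableSpace Ω] (P : Measure Ω) [IsProbabilityMeasure P]
      (Zs : Fin Ns → Ω → InputBall (dims 0) Ax × Y) (Zt : Fin Nt → Ω → InputBall (dims 0) Ax × Y),
    (∀ i, Measurable (Zs i)) → (∀ j, Measurable (Zt j)) →
    iIndepFun Zs P → iIndepFun Zt P →
    (∀ i, P.map (Zs i) = μs) → (∀ j, P.map (Zt j) = μt) →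
    -- with probability at least `1 - δ`, the bound holds for all transformations and hypotheses
    P {ω | ¬ ∀ θs θt : NetParams dims,
        θs.BoundedBy L AΘ → θt.BoundedBy L AΘ → θs.ShareLayer θt L →
        expLoss loss μt (output act L θt) ≤
          ((1 - α) * empLoss loss (fun i : Fin Ms => Zs (Fin.castLE hs i) ω) (output act L θs)
            + α * empLoss loss (fun j : Fin Mt => Zt (Fin.castLE ht j) ω) (output act L θt))
          + (1 - α) * R * empMMD (fun i => Zs i ω) (fun j => Zt j ω)
              (transform H act L θs) (transform H act L θt)
          + (1 - α) * R * ε + ε} ≤ ENNReal.ofReal δ := by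
  set K₀ := 128 * Lk + 8 * Lℓ with hK₀def
  have hK₀ : 0 < K₀ := by positivity
  obtain ⟨K, hK, hnetK⟩ := exists_featureNet hAx hAΘ hLη hAη hAop hκ hK₀ hδ
  -- losses with values in `[0, Aℓ]` satisfy the moment condition with both constants equal to `Aℓ`
  set c := min (bernsteinRate σs Cs) (min (bernsteinRate σt Ct) (bernsteinRate Aℓ Aℓ))
  have hcs : c ≤ bernsteinRate σs Cs := min_le_left _ _
  have hct : c ≤ bernsteinRate σt Ct := (min_le_right _ _).trans (min_le_left _ _)
  have hcℓ : c ≤ bernsteinRate Aℓ Aℓ := (min_le_right _ _).trans (min_le_right _ _)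
  have hc0 : 0 < c := lt_min (bernsteinRate_pos hσs hCs)
    (lt_min (bernsteinRate_pos hσt hCt) (bernsteinRate_pos hAℓ hAℓ))
  -- `K ρ` bounds the entropy, and Bernstein's inequality is applied with the deviation `ε / 4`,
  -- whose square accounts for the factor `16`
  set c₂ := 16 * K / c with hc₂def
  have hc₂ : 0 < c₂ := by positivity
  have hKc : K = c * c₂ / 16 := by rw [hc₂def]; field_simp
  set c₁ := 1 / ((1 + 2 * Aℓ) * √c₂) with hc₁def
  have hc₁ : 0 < c₁ := by positivity
  refine ⟨c₁, hc₁, c₂, hc₂, ?_⟩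
  intro L d ε dims hL hd hε hε1 hdims act hlip hact H _ _ _ _ hker Y hY loss hlossm hlossb hlossL
    μs μt _ _ hmom R hR hadapt Ms Mt Ns Nt hs ht α hα0 hα1 hαc hMs hNs hNt Ω _ P _ Zs Zt hZs hZt
    hinds hindt hlaws hlawt
  obtain ⟨ι, _, e, he, hcard, hnet⟩ := hnetK L d ε dims hL hd hε hε1 hdims act hlip hact
  have hρ := one_le_complexityRate hL hd hε hε1
  set ρ := complexityRate L d ε
  have hρ0 : 0 < ρ := one_pos.trans_le hρ
  have hL' : (1 : ℝ) ≤ L := by exact_mod_cast hL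
  set S : Set (NetParams dims) := {θ | θ.BoundedBy L AΘ}
  -- regularity of the two function classes
  set T : NetParams dims → InputBall (dims 0) Ax × Y → HiddenSpace H L :=
    fun θ z => transform H act L θ z.1
  set ℓ : NetParams dims → InputBall (dims 0) Ax × Y → ℝ :=
    fun θ z => loss (output act L θ z.1) z.2
  have hTcont : ∀ θ, Continuous (transform H act L (A := Ax) θ) :=
    continuous_transform H hlip hker
  have hTm : ∀ θ ∈ S, StronglyMeasurable (T θ) := fun θ _ =>
    (hTcont θ).stronglyMeasurable.comp_measurable measurable_fst
  have : CompactSpace (InputBall (dims 0) Ax) :=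
    isCompact_iff_compactSpace.1 (isCompact_closedBall _ _)
  have hTb : ∀ θ ∈ S, ∃ B : ℝ, ∀ z, ‖T θ z‖ ≤ B := fun θ _ => by
    obtain ⟨B, hB⟩ := isCompact_univ.exists_bound_of_continuousOn (hTcont θ).continuousOn
    exact ⟨B, fun z => hB z.1 (Set.mem_univ _)⟩
  have hℓb : ∀ θ ∈ S, ∀ z, 0 ≤ ℓ θ z ∧ ℓ θ z ≤ Aℓ := fun θ hθ z =>
    hlossb _ (hY θ hθ z.1) _ z.2.2
  have hℓm : ∀ θ ∈ S, StronglyMeasurable (ℓ θ) := fun θ hθ => by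
    have h1 : Measurable fun x : InputBall (dims 0) Ax => output act L θ x :=
      ((θ.continuous_feature hlip L le_rfl).comp continuous_subtype_val).measurable
    have h2 : Measurable fun z : InputBall (dims 0) Ax × Y =>
        ((⟨output act L θ z.1, hY θ hθ z.1⟩, z.2) : Y × Y) :=
      ((h1.comp measurable_fst).subtype_mk).prodMk measurable_snd
    exact (hlossm.comp h2).stronglyMeasurable
  have hℓb' : ∀ θ ∈ S, ∃ B : ℝ, ∀ z, ‖ℓ θ z‖ ≤ B := fun θ hθ =>
    ⟨Aℓ, fun z => by rw [Real.norm_of_nonneg (hℓb θ hθ z).1]; exact (hℓb θ hθ z).2⟩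
  -- the net of parameters is an `ε / 8`-net for both function classes
  have hε2 : ε ^ 2 ≤ ε := pow_le_of_le_one hε.le hε1 two_ne_zero
  have hTnet : ∀ θ ∈ S, ∃ i, ∀ z, ‖T θ z - T (e i) z‖ ≤ ε / 8 := fun θ hθ => by
    obtain ⟨i, hi⟩ := hnet θ hθ
    refine ⟨i, fun z => ?_⟩
    have h := norm_transform_sub_sq_le H (act := act) hLk.le hker (by positivity) (hi z.1)
    apply le_of_sq_le_sq _ (by positivity : 0 ≤ ε / 8)
    refine h.trans ?_
    have h1 : (L : ℝ) * (2 * Lk * (ε ^ 2 / (K₀ * L))) = 2 * Lk / K₀ * ε ^ 2 := by field_simp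
    have h2 : 2 * Lk / K₀ ≤ 1 / 64 := by
      rw [div_le_div_iff₀ hK₀ (by norm_num), hK₀def]
      linarith
    rw [h1]
    calc 2 * Lk / K₀ * ε ^ 2 ≤ 1 / 64 * ε ^ 2 := by gcongr
      _ = (ε / 8) ^ 2 := by ring
  have hℓnet : ∀ θ ∈ S, ∃ i, ∀ z, ‖ℓ θ z - ℓ (e i) z‖ ≤ ε / 8 := fun θ hθ => by
    obtain ⟨i, hi⟩ := hnet θ hθ
    refine ⟨i, fun z => ?_⟩
    have h2 : Lℓ / K₀ ≤ 1 / 8 := by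
      rw [div_le_div_iff₀ hK₀ (by norm_num), hK₀def]
      linarith
    calc ‖ℓ θ z - ℓ (e i) z‖ ≤ Lℓ * ‖output act L θ z.1 - output act L (e i) z.1‖ :=
          hlossL _ (hY θ hθ z.1) _ (hY (e i) (he i) z.1) _ z.2.2
      _ ≤ Lℓ * (ε ^ 2 / (K₀ * L)) := by
          gcongr
          exact hi z.1 L le_rfl
      _ = Lℓ / K₀ * (ε ^ 2 / L) := by field_simp
      _ ≤ 1 / 8 * (ε / 1) := by gcongr
      _ = ε / 8 := by ring
  -- sample sizes
  have hpos : ∀ N : ℕ, c₂ * (ρ / ε ^ 2) ≤ N → 0 < N := fun N hN => by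
    have : (0 : ℝ) < N := lt_of_lt_of_le (by positivity) hN
    exact_mod_cast this
  have hsize : ∀ N : ℕ, c₂ * (ρ / ε ^ 2) ≤ N → K * ρ ≤ c * N * (ε / 4) ^ 2 := fun N hN => by
    calc K * ρ = c * (c₂ * (ρ / ε ^ 2)) * (ε / 4) ^ 2 := by rw [hKc]; field_simp; norm_num
      _ ≤ _ := by gcongr
  have hind_Ms : iIndepFun (fun i : Fin Ms => Zs (Fin.castLE hs i)) P :=
    hinds.precomp (Fin.castLE_injective hs)
  have hind_Mt : iIndepFun (fun i : Fin Mt => Zt (Fin.castLE ht i)) P :=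
    hindt.precomp (Fin.castLE_injective ht)
  -- the four exceptional events
  have hε4 : ε / 4 ≤ 1 := by linarith
  have b1 := measure_exists_norm_sampleMean_sub_gt_le_of_entropy (hpos Ns hNs) hZs hinds hlaws
    (S := S) he hTm hTb hσs hCs (fun θ hθ => (hmom θ hθ).1) (by positivity) hε4 (by positivity)
    hTnet hcard hcs (hsize Ns hNs)
  have b2 := measure_exists_norm_sampleMean_sub_gt_le_of_entropy (hpos Nt hNt) hZt hindt hlawt
    (S := S) he hTm hTb hσt hCt (fun θ hθ => (hmom θ hθ).2) (by positivity) hε4 (by positivity)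
    hTnet hcard hct (hsize Nt hNt)
  have b3 := measure_exists_norm_sampleMean_sub_gt_le_of_entropy (hpos Ms hMs)
    (fun i => hZs (Fin.castLE hs i)) hind_Ms (fun i => hlaws _)
    (S := S) he hℓm hℓb' hAℓ hAℓ (fun θ hθ => moments_le_of_mem_Icc (hℓm θ hθ) hAℓ (hℓb θ hθ))
    (by positivity) hε4 (by positivity) hℓnet hcard hcℓ (hsize Ms hMs)
  have hc₁c₂ : c₁ * √c₂ = 1 / (1 + 2 * Aℓ) := by rw [hc₁def]; field_simp
  obtain ⟨B₄, hB₄, hB₄dev⟩ := exists_measure_le_targetWeight_mul_sub_le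
    (fun i => hZt (Fin.castLE ht i)) hind_Mt (fun i => hlawt _)
    (S := S) he hℓm hℓb hℓnet (hKc ▸ hcard) hcℓ hAℓ hc₁.le hc₂ hc₁c₂ hε hρ0 hα0 hα1 hαc
  set B₁ := {ω | ¬ ∀ θ ∈ S, ‖(1 / Ns : ℝ) • ∑ i, T θ (Zs i ω) - ∫ z, T θ z ∂μs‖
    ≤ ε / 4 + 2 * (ε / 8)} with hB₁
  set B₂ := {ω | ¬ ∀ θ ∈ S, ‖(1 / Nt : ℝ) • ∑ i, T θ (Zt i ω) - ∫ z, T θ z ∂μt‖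
    ≤ ε / 4 + 2 * (ε / 8)} with hB₂
  set B₃ := {ω | ¬ ∀ θ ∈ S, ‖(1 / Ms : ℝ) • ∑ i : Fin Ms, ℓ θ (Zs (Fin.castLE hs i) ω)
    - ∫ z, ℓ θ z ∂μs‖ ≤ ε / 4 + 2 * (ε / 8)} with hB₃
  have hunion : P (((B₁ ∪ B₂) ∪ B₃) ∪ B₄) ≤ ENNReal.ofReal δ := by
    have hδ4 : (0 : ℝ) ≤ δ / 4 := by positivity
    calc _ ≤ ENNReal.ofReal (δ / 4) + ENNReal.ofReal (δ / 4) + ENNReal.ofReal (δ / 4)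
          + ENNReal.ofReal (δ / 4) := by
          refine (measure_union_le _ _).trans (add_le_add ?_ hB₄)
          refine (measure_union_le _ _).trans (add_le_add ?_ b3)
          exact (measure_union_le _ _).trans (add_le_add b1 b2)
      _ = ENNReal.ofReal δ := by
          rw [← ENNReal.ofReal_add hδ4 hδ4, ← ENNReal.ofReal_add (by positivity) hδ4,
            ← ENNReal.ofReal_add (by positivity) hδ4]
          congr 1
          ring
  refine (measure_mono fun ω hω => ?_).trans hunion
  by_contra hgood
  simp only [Set.mem_union, not_or] at hgood
  obtain ⟨⟨⟨g1, g2⟩, g3⟩, g4⟩ := hgood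
  rw [hB₁, Set.mem_ofPred_eq, not_not] at g1
  rw [hB₂, Set.mem_ofPred_eq, not_not] at g2
  rw [hB₃, Set.mem_ofPred_eq, not_not] at g3
  refine hω fun θs θt hθs hθt hshare => ?_
  refine le_of_deviation_le hα1 hR.le hε.le hα0 (hadapt θs θt hθs hθt hshare) ?_ ?_
    (hB₄dev ω g4 θt hθt)
  · have h := mmd_le_empMMD_add (f := transform H act L θs) (f' := transform H act L θt)
      (z := fun i => Zs i ω) (z' := fun j => Zt j ω) (g1 θs hθs) (g2 θt hθt)
    refine h.trans_eq ?_
    ring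
  · have h1 := (neg_le_abs _).trans (g3 θs hθs)
    have h2 : expLoss loss μs (output act L θs)
        - empLoss loss (fun i : Fin Ms => Zs (Fin.castLE hs i) ω) (output act L θs)
        = -((1 / Ms : ℝ) • ∑ i : Fin Ms, ℓ θs (Zs (Fin.castLE hs i) ω) - ∫ z, ℓ θs z ∂μs) := by
      rw [neg_sub]
      rfl
    linarith
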